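/- **Setting.** Identify $S^1$ with $\mathbb{R}/2\pi\mathbb{Z}$, so that functions on $S^1$ are $2\pi$-periodic functions on $\mathbb{R}$. The Banach space $C^k(S^1;E)$ carries the norm $\|f\|_k=\max_{j\le k}\sup_\varphi\|f^{(j)}(\varphi)\|$. For $v=(x,y)\in\mathbb{R}^2$ put $v^\perp=(y,-x)$. Let $r>0$. For a continuous embedding $\gamma\colon S^1\to\mathbb{R}^2$ let $\operatorname{inn}(\gamma)$ be the bounded component of $\mathbb{R}^2\setminus\gamma(S^1)$, and let the circular integral invariant of $\gamma$ be $$I_r[\gamma](\varphi)=\operatorname{area}\bigl(B_r(\gamma(\varphi))\cap \operatorname{inn}(\gamma)\bigr),$$ where $B_r(x)$ is the disc of radius $r$ centred at $x$. Let $$p_\gamma(\varphi)=\inf\{\psi>\varphi:\ |\gamma(\psi)-\gamma(\varphi)|=r\},\qquad m_\gamma(\varphi)=\sup\{\psi<\varphi:\ |\gamma(\psi)-\gamma(\varphi)|=r\}$$ be the next and the previous parameter at which $\gamma$ meets the circle of radius $r$ centred at $\gamma(\varphi)$. **Theorem.** Let $k\ge 0$, $\ell\ge 1$, $r>0$ and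 $R>r/2$. There is an open neighbourhood $\mathcal{V}\subset C^{k+\ell+1}(S^1;\mathbb{R}^2)$ of the circle $\varphi\mapsto(R\cos\varphi,R\sin\varphi)$ such that every $\gamma\in\mathcal{V}$ is an embedding, for every $\gamma\in\mathcal V$ and every $\varphi$ the circle of radius $r$ centred at $\gamma(\varphi)$ meets $\gamma$ at exactly two parameters modulo $2\pi$, namely $p_\gamma(\varphi)$ and $m_\gamma(\varphi)$, with $p_\gamma(\varphi)<m_\gamma(\varphi)+2\pi$, and the following hold. (Here $\gamma,\sigma,p_\gamma,m_\gamma$ without argument are evaluated at $\varphi$; $\gamma(p_\gamma)$ means $\gamma(p_\gamma(\varphi))$, and so on.) 1. For every $\gamma\in\mathcal{V}$ and $\varphi\in S^1$, $$I_r[\gamma](\varphi)=\frac12\int_{m_\gamma}^{p_\gamma}\langle\gamma(\psi)-\gamma,\dot\gamma(\psi)^\perp\rangle\,d\psi+\frac{r^2}{2}\arccos\Bigl(\frac{\langle\gamma(p_\gamma)-\gamma,\gamma(m_\gamma)-\gamma\rangle}{r^2}\Bigr).$$ 2. For every $\gamma\in\mathcal V$ the function $I_r[\gamma]$ belongs to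 $C^k(S^1;\mathbb{R})$, and the map $I_r\colon\mathcal{V}\to C^k(S^1;\mathbb{R})$ is $\ell$ times continuously Fréchet differentiable. For $\gamma\in\mathcal{V}$ and $\varphi\in S^1$ the numbers $\langle\dot\gamma(p_\gamma),\gamma(p_\gamma)-\gamma\rangle$ and $\langle\dot\gamma(m_\gamma),\gamma(m_\gamma)-\gamma\rangle$ are nonzero and $r^4-\langle\gamma(p_\gamma)-\gamma,\gamma(m_\gamma)-\gamma\rangle^2>0$; writing, for $\sigma\in C^{k+\ell+1}(S^1;\mathbb{R}^2)$, $$P=\frac{\langle\sigma-\sigma(p_\gamma),\gamma(p_\gamma)-\gamma\rangle}{\langle\dot\gamma(p_\gamma),\gamma(p_\gamma)-\gamma\rangle},\qquad M=\frac{\langle\sigma-\sigma(m_\gamma),\gamma(m_\gamma)-\gamma\rangle}{\langle\dot\gamma(m_\gamma),\gamma(m_\gamma)-\gamma\rangle},$$ the derivative in direction $\sigma$ is given by $$\begin{aligned}2I_r'[\gamma](\sigma)(\varphi)={}&2\int_{m_\gamma}^{p_\gamma}\langle\sigma(\psi),\dot\gamma(\psi)^\perp\rangle\,d\psi-\lan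gle\sigma,\gamma(p_\gamma)^\perp-\gamma(m_\gamma)^\perp\rangle\\&+\langle\gamma(p_\gamma)-\gamma,\sigma(p_\gamma)^\perp\rangle-\langle\gamma(m_\gamma)-\gamma,\sigma(m_\gamma)^\perp\rangle\\&+\langle\gamma(p_\gamma)-\gamma,\dot\gamma(p_\gamma)^\perp\rangle\,P-\langle\gamma(m_\gamma)-\gamma,\dot\gamma(m_\gamma)^\perp\rangle\,M\\&-\frac{r^2}{\sqrt{r^4-\langle\gamma(p_\gamma)-\gamma,\gamma(m_\gamma)-\gamma\rangle^2}}\Bigl(P\,\langle\dot\gamma(p_\gamma),\gamma(m_\gamma)-\gamma\rangle+\langle\sigma(p_\gamma)-\sigma,\gamma(m_\gamma)-\gamma\rangle\\&\qquad+\langle\gamma(p_\gamma)-\gamma,\sigma(m_\gamma)-\sigma\rangle+M\,\langle\gamma(p_\gamma)-\gamma,\dot\gamma(m_\gamma)\rangle\Bigr).\end{aligned}$$ -/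

import Mathlib

open Set MeasureTheory
open scoped Real

noncomputable section

namespace CircInv

/-- The Euclidean plane. -/
abbrev Plane : Type := EuclideanSpace ℝ (Fin 2)

section CkSpace

variable (k : ℕ) (E : Type*) [NormedAddCommGroup E] [NormedSpace ℝ E]

/-- The `2π`-periodic functions of class `C^k` on the real line, as a linear subspace of all
functions. -/
def ckSubmodule : Submodule ℝ (ℝ → E) where
  carrier := {f | Function.Periodic f (2 * π) ∧ ContDiff ℝ k f}
  add_mem' := fun hf hg => ⟨hf.1.add hg.1, hf.2.add hg.2⟩
  zero_mem' := ⟨fun _ => rfl, contDiff_const⟩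
  smul_mem' := fun c _ hf => ⟨hf.1.smul c, contDiff_const.smul hf.2⟩

/-- The space `C^k(S¹; E)`, where functions on `S¹ = ℝ / 2πℤ` are regarded as `2π`-periodic functions
on the real line. (A definition and not an abbreviation, so that it carries only the `C^k`-norm
topology introduced below and not the topology of pointwise convergence.) -/
def CkCircle : Type _ := ckSubmodule k E

instance : AddCommGroup (CkCircle k E) := inferInstanceAs (AddCommGroup (ckSubmodule k E))

instance : Module ℝ (CkCircle k E) := inferInstanceAs (Module ℝ (ckSubmodule k E))

variable {k E}

instance : CoeFun (CkCircle k E) (fun _ => ℝ → E) := ⟨fun f => f.1⟩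

theorem CkCircle.periodic (f : CkCircle k E) : Function.Periodic f (2 * π) := f.2.1

theorem CkCircle.contDiff (f : CkCircle k E) : ContDiff ℝ k f := f.2.2

theorem CkCircle.periodic_iteratedDeriv (f : CkCircle k E) (j : ℕ) :
    Function.Periodic (iteratedDeriv j f) (2 * π) := by
  intro x
  have h := congrFun (iteratedDeriv_comp_add_const (n := j) (f := f) (s := 2 * π)) x
  rw [← h]
  congr 1
  funext z
  exact f.periodic z

theorem CkCircle.continuous_iteratedDeriv (f : CkCircle k E) (j : Fin (k + 1)) :
    Continuous (iteratedDeriv (j : ℕ) f) :=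
  f.contDiff.continuous_iteratedDeriv j (by exact_mod_cast Nat.lt_succ_iff.mp j.2)

/-- The `j`-th derivative (`j ≤ k`) of an element of `C^k(S¹; E)`, as a bounded continuous
function. -/
def CkCircle.derivBCF (f : CkCircle k E) (j : Fin (k + 1)) : BoundedContinuousFunction ℝ E :=
  BoundedContinuousFunction.mkOfBound ⟨iteratedDeriv (j : ℕ) f, f.continuous_iteratedDeriv j⟩
    (Metric.diam (range (iteratedDeriv (j : ℕ) f)))
    (fun x y => Metric.dist_le_diam_of_mem
      ((f.periodic_iteratedDeriv j).isBounded_of_continuous (by positivity)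
        (f.continuous_iteratedDeriv j)) (mem_range_self x) (mem_range_self y))

variable (k E)

/-- The linear map `f ↦ (f, f', …, f^(k))` into the `(k+1)`-fold product of the space of bounded
continuous functions. -/
def CkCircle.jet : CkCircle k E →ₗ[ℝ] (Fin (k + 1) → BoundedContinuousFunction ℝ E) where
  toFun f j := f.derivBCF j
  map_add' f g := by
    funext j
    ext x
    have hj : ((j : ℕ) : WithTop ℕ∞) ≤ k := by exact_mod_cast Nat.lt_succ_iff.mp j.2
    exact iteratedDeriv_add (f.contDiff.contDiffAt.of_le hj) (g.contDiff.contDiffAt.of_le hj)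
  map_smul' c f := by
    funext j
    ext x
    have hj : ((j : ℕ) : WithTop ℕ∞) ≤ k := by exact_mod_cast Nat.lt_succ_iff.mp j.2
    exact iteratedDeriv_const_smul (f.contDiff.contDiffAt.of_le hj) c

theorem CkCircle.jet_injective : Function.Injective (CkCircle.jet k E) := by
  intro f g h
  apply Subtype.ext
  funext x
  have h0 := congrArg (fun F : BoundedContinuousFunction ℝ E => F x) (congrFun h 0)
  exact h0

/-- The `C^k`-norm `‖f‖ = max_{j ≤ k} sup_φ ‖f^(j)(φ)‖`. -/
instance : NormedAddCommGroup (CkCircle k E) :=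
  NormedAddCommGroup.induced (CkCircle k E) (Fin (k + 1) → BoundedContinuousFunction ℝ E)
    (CkCircle.jet k E) (CkCircle.jet_injective k E)

instance : NormedSpace ℝ (CkCircle k E) :=
  NormedSpace.induced ℝ (CkCircle k E) (Fin (k + 1) → BoundedContinuousFunction ℝ E)
    (CkCircle.jet k E)

end CkSpace

/-- The constant speed parametrization `φ ↦ (R cos φ, R sin φ)` of the circle of radius `R`. -/
def circleCurve (k : ℕ) (R : ℝ) : CkCircle k Plane :=
  ⟨fun φ => !₂[R * Real.cos φ, R * Real.sin φ], by
    refine ⟨fun φ => ?_, ?_⟩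
    · simp
    · rw [contDiff_euclidean]
      intro i
      fin_cases i
      · exact contDiff_const.mul Real.contDiff_cos
      · exact contDiff_const.mul Real.contDiff_sin⟩

/-- A `2π`-periodic curve is an embedding of the circle if it is injective on a period. -/
def IsEmbedded (γ : ℝ → Plane) : Prop := InjOn γ (Ico 0 (2 * π))

/-- The interior of a closed curve: the union of the bounded connected components of the complement
of its trace (for a Jordan curve there is exactly one). -/
def inn (γ : ℝ → Plane) : Set Plane :=
  {x | x ∉ range γ ∧ Bornology.IsBounded (connectedComponentIn (range γ)ᶜ x)}

/-- The circular integral invariant `I_r[γ](φ)`: the area of `B_r(γ(φ)) ∩ inn(γ)`. -/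
def invariant (r : ℝ) (γ : ℝ → Plane) (φ : ℝ) : ℝ :=
  (volume (Metric.ball (γ φ) r ∩ inn γ)).toReal

/-- `p_γ(φ)`: the next parameter after `φ` at which `γ` meets the circle of radius `r` centred
at `γ(φ)`. -/
def nextParam (r : ℝ) (γ : ℝ → Plane) (φ : ℝ) : ℝ :=
  sInf {ψ | φ < ψ ∧ dist (γ ψ) (γ φ) = r}

/-- `m_γ(φ)`: the last parameter before `φ` at which `γ` meets the circle of radius `r` centred
at `γ(φ)`. -/
def prevParam (r : ℝ) (γ : ℝ → Plane) (φ : ℝ) : ℝ :=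
  sSup {ψ | ψ < φ ∧ dist (γ ψ) (γ φ) = r}

/-- Clockwise rotation by a right angle, `(x, y)^⊥ = (y, -x)`. -/
def perp (v : Plane) : Plane := !₂[v 1, -v 0]

/-- The Euclidean inner product of the plane. -/
local notation "⟪" v ", " w "⟫" => (Inner.inner ℝ (v : Plane) (w : Plane) : ℝ)

/-- The right-hand side of the formula for `I_r[γ](φ)`. -/
def invariantFormula (r : ℝ) (γ : ℝ → Plane) (φ : ℝ) : ℝ :=
  let p := nextParam r γ φ
  let m := prevParam r γ φ
  1 / 2 * (∫ ψ in m..p, ⟪γ ψ - γ φ, perp (deriv γ ψ)⟫)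
    + r ^ 2 / 2 * Real.arccos (⟪γ p - γ φ, γ m - γ φ⟫ / r ^ 2)

/-- The right-hand side of the formula for `2 I_r'[γ](σ)(φ)`. -/
def twiceDerivFormula (r : ℝ) (γ σ : ℝ → Plane) (φ : ℝ) : ℝ :=
  let p := nextParam r γ φ
  let m := prevParam r γ φ
  2 * (∫ ψ in m..p, ⟪σ ψ, perp (deriv γ ψ)⟫)
    - ⟪σ φ, perp (γ p) - perp (γ m)⟫
    + ⟪γ p - γ φ, perp (σ p)⟫
    - ⟪γ m - γ φ, perp (σ m)⟫
    + ⟪γ p - γ φ, perp (deriv γ p)⟫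
        * (⟪σ φ - σ p, γ p - γ φ⟫ / ⟪deriv γ p, γ p - γ φ⟫)
    - ⟪γ m - γ φ, perp (deriv γ m)⟫
        * (⟪σ φ - σ m, γ m - γ φ⟫ / ⟪deriv γ m, γ m - γ φ⟫)
    - r ^ 2 / √(r ^ 4 - ⟪γ p - γ φ, γ m - γ φ⟫ ^ 2)
        * (⟪σ φ - σ p, γ p - γ φ⟫ / ⟪deriv γ p, γ p - γ φ⟫ * ⟪deriv γ p, γ m - γ φ⟫
          + ⟪σ p - σ φ, γ m - γ φ⟫
          + ⟪γ p - γ φ, σ m - σ φ⟫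
          + ⟪σ φ - σ m, γ m - γ φ⟫ / ⟪deriv γ m, γ m - γ φ⟫ * ⟪γ p - γ φ, deriv γ m⟫)

/-- The circle of radius `r` centred at `γ(φ)` meets the closed curve `γ` at exactly two parameters
per period, namely `p_γ(φ)` and `m_γ(φ)` (modulo `2π`). -/
def MeetsTwice (r : ℝ) (γ : ℝ → Plane) (φ : ℝ) : Prop :=
  {ψ ∈ Ioo φ (φ + 2 * π) | dist (γ ψ) (γ φ) = r}
      = {nextParam r γ φ, prevParam r γ φ + 2 * π}
    ∧ nextParam r γ φ < prevParam r γ φ + 2 * π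

/-- None of the denominators in the formula for `I_r'[γ]` vanishes. -/
def NonDegenerate (r : ℝ) (γ : ℝ → Plane) (φ : ℝ) : Prop :=
  let p := nextParam r γ φ
  let m := prevParam r γ φ
  ⟪deriv γ p, γ p - γ φ⟫ ≠ 0 ∧ ⟪deriv γ m, γ m - γ φ⟫ ≠ 0
    ∧ 0 < r ^ 4 - ⟪γ p - γ φ, γ m - γ φ⟫ ^ 2

end CircInv

end

/-!
In the `C²`-topology the following is an open condition around the circle: every tangent line meets
the curve only at its point of contact, with the rest of the curve on its left, and the distance
from `γ φ` to `γ ψ` is strictly monotone in `|ψ - φ| ≤ x₁` and exceeds `r` for larger parameter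
distances. Then the chords issuing from `γ φ` sweep out `inn γ` injectively, and integrating their
lengths, cut off at `r`, in polar coordinates gives the area: the arc inside the disc contributes
the line integral, and the arc outside contributes `r² / 2` times the angle between the chords that
end at `γ (p_γ φ)` and `γ (m_γ φ)`.

The evaluation `(γ, φ) ↦ γ φ` is of class `C^(n-1)` on `C^n(S¹) × ℝ`, hence so are `p` and `m` by
the implicit function theorem. The line integral loses no further derivative, because it is a
difference of values of the bilinear form `(f, g) ↦ ∫₀ˢ cross f g'`, whose dependence on `s` is one
order smoother than that of its integrand. So `(γ, φ) ↦ I_r[γ](φ)` is of class `C^(k+ℓ)`, and a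
function which is jointly `C^(k+ℓ)` is, by currying, of class `C^ℓ` with values in `C^k(S¹)`. Its
derivative can then be computed pointwise in `φ` along curves through `γ` with velocity `σ`, where
integration by parts turns the two terms of the differentiated line integral into one.
-/

open scoped Topology

noncomputable section

namespace CircInv

local notation "⟪" v ", " w "⟫" => (Inner.inner ℝ (v : Plane) (w : Plane) : ℝ)

namespace CkCircle

variable {k : ℕ} {E : Type*} [NormedAddCommGroup E] [NormedSpace ℝ E]

/-- The element of `C^k(S¹; E)` given by a periodic function of class `C^k`. -/
def ofPeriodic (f : ℝ → E) (hp : Function.Periodic f (2 * π)) (hf : ContDiff ℝ k f) :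
    CkCircle k E :=
  ⟨f, hp, hf⟩

@[simp]
theorem coe_ofPeriodic (f : ℝ → E) (hp : Function.Periodic f (2 * π)) (hf : ContDiff ℝ k f) :
    (ofPeriodic f hp hf : ℝ → E) = f := rfl

variable (k E) in
/-- The jet map as a linear isometry, which is what it is by definition of the `C^k`-norm. -/
def jetIsometry : CkCircle k E →ₗᵢ[ℝ] (Fin (k + 1) → BoundedContinuousFunction ℝ E) :=
  { jet k E with norm_map' := fun _ => rfl }

@[ext]
theorem ext {f g : CkCircle k E} (h : ∀ x, f x = g x) : f = g := Subtype.ext (funext h)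

@[simp]
theorem sub_apply (f g : CkCircle k E) (x : ℝ) : (f - g) x = f x - g x := rfl

/-! ### Norm estimates -/

theorem norm_iteratedDeriv_le (f : CkCircle k E) {j : ℕ} (hj : j ≤ k) (x : ℝ) :
    ‖iteratedDeriv j f x‖ ≤ ‖f‖ :=
  ((jetIsometry k E f ⟨j, Nat.lt_succ_of_le hj⟩).norm_coe_le_norm x).trans
    (norm_le_pi_norm (jetIsometry k E f) ⟨j, Nat.lt_succ_of_le hj⟩)

theorem norm_le_of_iteratedDeriv_le (f : CkCircle k E) {C : ℝ} (hC : 0 ≤ C)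
    (h : ∀ j ≤ k, ∀ x, ‖iteratedDeriv j f x‖ ≤ C) : ‖f‖ ≤ C :=
  (pi_norm_le_iff_of_nonneg hC).2 fun j => (BoundedContinuousFunction.norm_le hC).2
    fun x => h j (Nat.lt_succ_iff.mp j.2) x

theorem hasDerivAt_iteratedDeriv (f : CkCircle k E) {j : ℕ} (hj : j < k) (x : ℝ) :
    HasDerivAt (iteratedDeriv j f) (iteratedDeriv (j + 1) f x) x := by
  rw [iteratedDeriv_succ]
  exact (f.contDiff.differentiable_iteratedDeriv j (by exact_mod_cast hj) x).hasDerivAt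

theorem norm_iteratedDeriv_sub_le (f : CkCircle k E) {j : ℕ} (hj : j < k) (s t : ℝ) :
    ‖iteratedDeriv j f t - iteratedDeriv j f s‖ ≤ ‖f‖ * |t - s| :=
  convex_univ.norm_image_sub_le_of_norm_hasDerivWithin_le
    (fun x _ => (f.hasDerivAt_iteratedDeriv hj x).hasDerivWithinAt)
    (fun x _ => f.norm_iteratedDeriv_le (Nat.succ_le_of_lt hj) x) (mem_univ s) (mem_univ t)

theorem norm_iteratedDeriv_taylor_le (f : CkCircle k E) {j : ℕ} (hj : j + 1 < k) (s t : ℝ) :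
    ‖iteratedDeriv j f t - iteratedDeriv j f s - (t - s) • iteratedDeriv (j + 1) f s‖
      ≤ ‖f‖ * (t - s) ^ 2 := by
  have hd : ∀ x, HasDerivAt
      (fun x => iteratedDeriv j f x - (x - s) • iteratedDeriv (j + 1) f s)
      (iteratedDeriv (j + 1) f x - iteratedDeriv (j + 1) f s) x := fun x => by
    simpa using (f.hasDerivAt_iteratedDeriv (Nat.lt_of_succ_lt hj) x).fun_sub
      (((hasDerivAt_id x).sub_const s).smul_const (iteratedDeriv (j + 1) f s))
  have h := (convex_uIcc s t).norm_image_sub_le_of_norm_hasDerivWithin_le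
    (C := ‖f‖ * |t - s|) (fun x _ => (hd x).hasDerivWithinAt)
    (fun x hx => (f.norm_iteratedDeriv_sub_le hj s x).trans
      (mul_le_mul_of_nonneg_left (abs_sub_left_of_mem_uIcc hx) (norm_nonneg f)))
    left_mem_uIcc right_mem_uIcc
  rwa [sub_self, zero_smul, sub_zero, sub_right_comm, mul_assoc, Real.norm_eq_abs,
    abs_mul_abs_self, ← sq] at h

theorem continuous (f : CkCircle k E) : Continuous f := f.contDiff.continuous

theorem continuous_deriv (hk : 1 ≤ k) (f : CkCircle k E) : Continuous (deriv f) :=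
  f.contDiff.continuous_deriv (by exact_mod_cast hk)

theorem hasDerivAt (hk : 1 ≤ k) (f : CkCircle k E) (x : ℝ) : HasDerivAt f (deriv f x) x := by
  simpa only [iteratedDeriv_zero, zero_add, iteratedDeriv_one] using
    f.hasDerivAt_iteratedDeriv (j := 0) hk x

theorem norm_deriv_le (hk : 1 ≤ k) (f : CkCircle k E) (x : ℝ) : ‖deriv f x‖ ≤ ‖f‖ := by
  simpa only [iteratedDeriv_one] using f.norm_iteratedDeriv_le hk x

theorem norm_sub_le (hk : 1 ≤ k) (f : CkCircle k E) (s t : ℝ) :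
    ‖f t - f s‖ ≤ ‖f‖ * |t - s| := by
  simpa only [iteratedDeriv_zero] using f.norm_iteratedDeriv_sub_le (j := 0) hk s t

theorem norm_taylor_le (hk : 2 ≤ k) (f : CkCircle k E) (s t : ℝ) :
    ‖f t - f s - (t - s) • deriv f s‖ ≤ ‖f‖ * (t - s) ^ 2 := by
  simpa only [iteratedDeriv_zero, zero_add, iteratedDeriv_one] using
    f.norm_iteratedDeriv_taylor_le (j := 0) hk s t

/-! ### Completeness -/

section Complete

variable {u : ℕ → CkCircle k E} {g : Fin (k + 1) → BoundedContinuousFunction ℝ E}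

theorem tendstoUniformly_of_tendsto_jet
    (hg : Filter.Tendsto (fun i => jet k E (u i)) Filter.atTop (𝓝 g)) (j : Fin (k + 1)) :
    TendstoUniformly (fun i => iteratedDeriv (j : ℕ) (u i)) (g j) Filter.atTop :=
  BoundedContinuousFunction.tendsto_iff_tendstoUniformly.1 (tendsto_pi_nhds.1 hg j)

theorem hasDerivAt_of_tendsto_jet
    (hg : Filter.Tendsto (fun i => jet k E (u i)) Filter.atTop (𝓝 g)) {j : ℕ}
    (hj : j + 1 < k + 1) (x : ℝ) :
    HasDerivAt (g ⟨j, Nat.lt_of_succ_lt hj⟩) (g ⟨j + 1, hj⟩ x) x :=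
  hasDerivAt_of_tendstoUniformly (tendstoUniformly_of_tendsto_jet hg ⟨j + 1, hj⟩)
    (.of_forall fun i x => (u i).hasDerivAt_iteratedDeriv (Nat.succ_lt_succ_iff.1 hj) x)
    (fun x => (tendstoUniformly_of_tendsto_jet hg ⟨j, _⟩).tendsto_at x) x

theorem iteratedDeriv_of_tendsto_jet
    (hg : Filter.Tendsto (fun i => jet k E (u i)) Filter.atTop (𝓝 g)) {j : ℕ} (hj : j < k + 1) :
    iteratedDeriv j (g 0) = g ⟨j, hj⟩ := by
  induction j with
  | zero => exact iteratedDeriv_zero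
  | succ j ih =>
    rw [iteratedDeriv_succ, ih (Nat.lt_of_succ_lt hj)]
    exact funext fun x => (hasDerivAt_of_tendsto_jet hg hj x).deriv

theorem isClosed_range_jet : IsClosed (range (jet k E)) := by
  refine IsSeqClosed.isClosed fun v g hv hg => ?_
  choose u hu using hv
  obtain rfl : (fun i => jet k E (u i)) = v := funext hu
  have hper : Function.Periodic (g 0) (2 * π) := fun x =>
    tendsto_nhds_unique ((tendstoUniformly_of_tendsto_jet hg 0).tendsto_at (x + 2 * π))
      (((tendstoUniformly_of_tendsto_jet hg 0).tendsto_at x).congr fun i =>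
        ((u i).periodic_iteratedDeriv _ x).symm)
  have hsmooth : ContDiff ℝ k (g 0) := by
    refine contDiff_nat_iff_iteratedDeriv.2 ⟨fun j hj => ?_, fun j hj => ?_⟩
    · rw [iteratedDeriv_of_tendsto_jet hg (Nat.lt_succ_of_le hj)]
      exact (g _).continuous
    · rw [iteratedDeriv_of_tendsto_jet hg (hj.trans k.lt_succ_self)]
      exact fun x => (hasDerivAt_of_tendsto_jet hg (Nat.succ_lt_succ hj) x).differentiableAt
  refine ⟨ofPeriodic (g 0) hper hsmooth, funext fun j => ?_⟩
  ext x
  exact congrFun (iteratedDeriv_of_tendsto_jet hg j.2) x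

instance [CompleteSpace E] : CompleteSpace (CkCircle k E) := by
  rw [completeSpace_iff_isComplete_range (jetIsometry k E).isometry.isUniformInducing]
  exact isClosed_range_jet.isComplete

end Complete

/-! ### Evaluation of derivatives -/

/-- The evaluation `f ↦ f^(j)(s)` of the `j`-th derivative at a point, as a continuous linear
map. -/
def evJet {j : ℕ} (hj : j ≤ k) (s : ℝ) : CkCircle k E →L[ℝ] E :=
  (BoundedContinuousFunction.evalCLM ℝ s) ∘L
    (ContinuousLinearMap.proj (R := ℝ) (⟨j, Nat.lt_succ_of_le hj⟩ : Fin (k + 1))) ∘L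
      (jetIsometry k E).toContinuousLinearMap

theorem evJet_apply {j : ℕ} (hj : j ≤ k) (s : ℝ) (f : CkCircle k E) :
    evJet hj s f = iteratedDeriv j f s := rfl

theorem evJet_zero_apply (s : ℝ) (f : CkCircle k E) : evJet (Nat.zero_le k) s f = f s := by
  rw [evJet_apply, iteratedDeriv_zero]

theorem evJet_one_apply (hk : 1 ≤ k) (s : ℝ) (f : CkCircle k E) : evJet hk s f = deriv f s := by
  rw [evJet_apply, iteratedDeriv_one]

theorem deriv_sub (hk : 1 ≤ k) (f g : CkCircle k E) (x : ℝ) :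
    deriv (f - g) x = deriv f x - deriv g x := by
  simpa only [evJet_one_apply] using (evJet hk x).map_sub f g

theorem hasDerivAt_evJet {j : ℕ} (hj : j + 2 ≤ k) (s : ℝ) :
    HasDerivAt (fun s => (evJet (by lia : j ≤ k) s : CkCircle k E →L[ℝ] E))
      (evJet (by lia : j + 1 ≤ k) s) s := by
  rw [hasDerivAt_iff_isLittleO]
  refine (Asymptotics.isBigO_of_le _ fun t => ContinuousLinearMap.opNorm_le_bound _
    (norm_nonneg _) fun f => ?_).trans_isLittleO (Asymptotics.isLittleO_pow_sub_sub s one_lt_two)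
  rw [norm_pow, norm_norm, Real.norm_eq_abs, sq_abs, mul_comm]
  exact f.norm_iteratedDeriv_taylor_le hj s t

theorem continuous_evJet {j : ℕ} (hj : j < k) :
    Continuous (fun s => (evJet hj.le s : CkCircle k E →L[ℝ] E)) := by
  refine LipschitzWith.continuous (K := 1) (LipschitzWith.of_dist_le_mul fun t s => ?_)
  rw [dist_eq_norm, NNReal.coe_one, one_mul]
  refine ContinuousLinearMap.opNorm_le_bound _ dist_nonneg fun f => ?_
  rw [mul_comm]
  exact f.norm_iteratedDeriv_sub_le hj s t

theorem contDiff_evJet {m j : ℕ} (hj : j + m + 1 ≤ k) :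
    ContDiff ℝ m (fun s => (evJet (by lia : j ≤ k) s : CkCircle k E →L[ℝ] E)) := by
  induction m generalizing j with
  | zero => exact contDiff_zero.2 (continuous_evJet (by lia))
  | succ m ih =>
    have hd := hasDerivAt_evJet (E := E) (j := j) (k := k) (by lia)
    push_cast
    refine contDiff_succ_iff_deriv.2 ⟨fun s => (hd s).differentiableAt, by simp, ?_⟩
    rw [funext fun s => (hd s).deriv]
    exact ih (by lia)

theorem contDiff_eval {m : ℕ} (hm : m + 1 ≤ k) :
    ContDiff ℝ m (fun z : CkCircle k E × ℝ => z.1 z.2) := by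
  have h := ((contDiff_evJet (k := k) (E := E) (j := 0) (m := m) (by lia)).comp
    (contDiff_snd (E := CkCircle k E) (F := ℝ))).clm_apply (contDiff_fst (E := CkCircle k E))
  simpa only [Function.comp_def, evJet_zero_apply] using h

end CkCircle

/-! ### The exponential law -/

section Separating

variable {X Y E ι : Type*} [NormedAddCommGroup X] [NormedSpace ℝ X]
  [NormedAddCommGroup Y] [NormedSpace ℝ Y] [CompleteSpace Y]
  [NormedAddCommGroup E] [NormedSpace ℝ E] [CompleteSpace E]
  {ev : ι → Y →L[ℝ] E} {J : X → Y} {A : X → X →L[ℝ] Y} {s : Set X} {x y : X}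

theorem sub_eq_integral_of_separating (hev : ∀ y z, (∀ i, ev i y = ev i z) → y = z)
    (hd : ∀ z ∈ s, ∀ i, HasFDerivAt (fun z => ev i (J z)) (ev i ∘L A z) z)
    (hA : ContinuousOn A s) (hs : Convex ℝ s) (hx : x ∈ s) (hy : y ∈ s) :
    J y - J x = ∫ t in (0 : ℝ)..1, A (AffineMap.lineMap x y t) (y - x) := by
  have hmem : ∀ t ∈ uIcc (0 : ℝ) 1, AffineMap.lineMap x y t ∈ s := fun t ht =>
    hs.lineMap_mem hx hy (by rwa [uIcc_of_le zero_le_one] at ht)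
  have hcont : ContinuousOn (fun t : ℝ => A (AffineMap.lineMap x y t) (y - x)) (uIcc 0 1) :=
    (hA.comp AffineMap.lineMap_continuous.continuousOn hmem).clm_apply continuousOn_const
  refine hev _ _ fun i => ?_
  have hderiv : ∀ t ∈ uIcc (0 : ℝ) 1, HasDerivAt (fun t : ℝ => ev i (J (AffineMap.lineMap x y t)))
      (ev i (A (AffineMap.lineMap x y t) (y - x))) t := fun t ht =>
    (hd _ (hmem t ht) i).comp_hasDerivAt t AffineMap.hasDerivAt_lineMap
  rw [← (ev i).intervalIntegral_comp_comm hcont.intervalIntegrable,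
    intervalIntegral.integral_eq_sub_of_hasDerivAt hderiv
      ((ev i).continuous.comp_continuousOn hcont).intervalIntegrable,
    AffineMap.lineMap_apply_one, AffineMap.lineMap_apply_zero, map_sub]

theorem norm_sub_sub_le_of_separating (hev : ∀ y z, (∀ i, ev i y = ev i z) → y = z)
    (hd : ∀ z ∈ s, ∀ i, HasFDerivAt (fun z => ev i (J z)) (ev i ∘L A z) z)
    (hA : ContinuousOn A s) (hs : Convex ℝ s) (hx : x ∈ s) (hy : y ∈ s) {c : ℝ}
    (hc : ∀ z ∈ s, ‖A z - A x‖ ≤ c) :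
    ‖J y - J x - A x (y - x)‖ ≤ c * ‖y - x‖ := by
  have hmem : ∀ t ∈ Icc (0 : ℝ) 1, AffineMap.lineMap x y t ∈ s := fun t => hs.lineMap_mem hx hy
  have hint : IntervalIntegrable (fun t : ℝ => A (AffineMap.lineMap x y t) (y - x)) volume 0 1 := by
    refine ContinuousOn.intervalIntegrable ?_
    rw [uIcc_of_le zero_le_one]
    exact (hA.comp AffineMap.lineMap_continuous.continuousOn hmem).clm_apply continuousOn_const
  have hremainder : J y - J x - A x (y - x)
      = ∫ t in (0 : ℝ)..1, (A (AffineMap.lineMap x y t) - A x) (y - x) := by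
    simp only [sub_apply]
    rw [intervalIntegral.integral_sub hint intervalIntegrable_const,
      ← sub_eq_integral_of_separating hev hd hA hs hx hy, intervalIntegral.integral_const,
      sub_zero, one_smul]
  have hbound := intervalIntegral.norm_integral_le_of_norm_le_const (a := (0 : ℝ)) (b := 1)
    (C := c * ‖y - x‖) (f := fun t => (A (AffineMap.lineMap x y t) - A x) (y - x))
    fun t ht => by
      rw [uIoc_of_le zero_le_one] at ht
      exact (ContinuousLinearMap.le_opNorm _ _).trans
        (mul_le_mul_of_nonneg_right (hc _ (hmem t (Ioc_subset_Icc_self ht))) (norm_nonneg _))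
  rwa [sub_zero, abs_one, mul_one, ← hremainder] at hbound

theorem hasFDerivAt_of_separating (hev : ∀ y z, (∀ i, ev i y = ev i z) → y = z)
    (hd : ∀ z ∈ s, ∀ i, HasFDerivAt (fun z => ev i (J z)) (ev i ∘L A z) z)
    (hA : ContinuousOn A s) (hs : IsOpen s) (hx : x ∈ s) : HasFDerivAt J (A x) x := by
  rw [hasFDerivAt_iff_isLittleO, Asymptotics.isLittleO_iff]
  intro c hc
  obtain ⟨ρ, hρ, hball⟩ := Metric.mem_nhds_iff.1 (Filter.inter_mem (hs.mem_nhds hx)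
    ((hA.continuousAt (hs.mem_nhds hx)).preimage_mem_nhds (Metric.closedBall_mem_nhds _ hc)))
  filter_upwards [Metric.ball_mem_nhds x hρ] with y hy
  exact norm_sub_sub_le_of_separating hev (fun z hz => hd z (hball hz).1)
    (hA.mono fun z hz => (hball hz).1) (convex_ball x ρ) (Metric.mem_ball_self hρ) hy
    fun z hz => mem_closedBall_iff_norm.1 (hball hz).2

end Separating

section Uncurry

variable {X E : Type*} [NormedAddCommGroup X] [NormedSpace ℝ X]
  [NormedAddCommGroup E] [NormedSpace ℝ E] {V : Set X} {F : X → ℝ → E} {n : WithTop ℕ∞} {x : X}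

theorem hasFDerivAt_of_contDiffOn_uncurry (hn : n ≠ 0) (hV : IsOpen V)
    (hF : ContDiffOn ℝ n (Function.uncurry F) (V ×ˢ univ)) (hx : x ∈ V) (φ : ℝ) :
    HasFDerivAt (Function.uncurry F) (fderiv ℝ (Function.uncurry F) (x, φ)) (x, φ) :=
  ((hF.contDiffAt ((hV.prod isOpen_univ).mem_nhds
    (⟨hx, mem_univ φ⟩ : (x, φ) ∈ V ×ˢ univ))).differentiableAt hn).hasFDerivAt

theorem contDiff_of_contDiffOn_uncurry (hF : ContDiffOn ℝ n (Function.uncurry F) (V ×ˢ univ))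
    (hx : x ∈ V) : ContDiff ℝ n (F x) := by
  rw [← contDiffOn_univ]
  exact hF.comp (contDiff_prodMk_right x).contDiffOn fun φ _ => ⟨hx, mem_univ φ⟩

theorem contDiffOn_uncurry_deriv (hV : IsOpen V)
    (hF : ContDiffOn ℝ (n + 1) (Function.uncurry F) (V ×ˢ univ)) :
    ContDiffOn ℝ n (Function.uncurry fun x φ => deriv (F x) φ) (V ×ˢ univ) := by
  refine ((hF.fderiv_of_isOpen (hV.prod isOpen_univ) le_rfl).clm_apply
    (contDiffOn_const (c := ((0 : X), (1 : ℝ))))).congr ?_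
  rintro ⟨x, φ⟩ ⟨hx, -⟩
  exact ((hasFDerivAt_of_contDiffOn_uncurry (by simp) hV hF hx φ).comp_hasDerivAt φ
    ((hasDerivAt_const φ x).prodMk (hasDerivAt_id φ))).deriv

theorem contDiffOn_uncurry_iteratedDeriv {m : ℕ} (hV : IsOpen V) (j : ℕ)
    (hF : ContDiffOn ℝ (j + m : ℕ) (Function.uncurry F) (V ×ˢ univ)) :
    ContDiffOn ℝ m (Function.uncurry fun x φ => iteratedDeriv j (F x) φ) (V ×ˢ univ) := by
  induction j generalizing m with
  | zero => simpa only [iteratedDeriv_zero, zero_add] using hF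
  | succ j ih =>
    have h : ContDiffOn ℝ (j + (m + 1) : ℕ) (Function.uncurry F) (V ×ˢ univ) := by
      rwa [show j + (m + 1) = j + 1 + m by lia]
    simpa only [iteratedDeriv_succ] using
      contDiffOn_uncurry_deriv hV (n := m) (by exact_mod_cast ih h)

theorem eventually_dist_iteratedDeriv_lt {k j : ℕ} (hj : j ≤ k) (hV : IsOpen V)
    (hF : ContDiffOn ℝ k (Function.uncurry F) (V ×ˢ univ)) (hx : x ∈ V) {K : Set ℝ}
    (hK : IsCompact K) {ε : ℝ} (hε : 0 < ε) :
    ∀ᶠ y in 𝓝[V] x, ∀ φ ∈ K, dist (iteratedDeriv j (F y) φ) (iteratedDeriv j (F x) φ) < ε := by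
  have hc : ContinuousOn (Function.uncurry fun x φ => iteratedDeriv j (F x) φ) (V ×ˢ K) :=
    (ContDiffOn.continuousOn (n := (0 : ℕ)) (contDiffOn_uncurry_iteratedDeriv hV j
      (hF.of_le (by exact_mod_cast hj)))).mono (prod_mono le_rfl (subset_univ _))
  obtain ⟨v, hv, h⟩ := hK.mem_uniformity_of_prod hc hx (Metric.dist_mem_uniformity hε)
  filter_upwards [hv] with y hy φ hφ using h y hy φ hφ

end Uncurry

namespace CkCircle

section ApplyCLM

variable {X E : Type*} [NormedAddCommGroup X] [NormedSpace ℝ X]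
  [NormedAddCommGroup E] [NormedSpace ℝ E] {k : ℕ}

/-- The curve of vectors obtained by applying a curve of operators to a fixed vector. -/
def applyVec (T : CkCircle k (X →L[ℝ] E)) (v : X) : CkCircle k E :=
  .ofPeriodic (fun φ => T φ v) (fun φ => by simp only [T.periodic φ])
    (T.contDiff.clm_apply contDiff_const)

theorem iteratedDeriv_applyVec (T : CkCircle k (X →L[ℝ] E)) (v : X) {j : ℕ} (hj : j ≤ k) :
    iteratedDeriv j (T.applyVec v) = fun φ => iteratedDeriv j T φ v := by
  induction j with
  | zero => simp only [iteratedDeriv_zero]; rfl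
  | succ j ih =>
    rw [iteratedDeriv_succ, ih (Nat.le_of_succ_le hj)]
    funext φ
    exact ((T.hasDerivAt_iteratedDeriv hj φ).clm_apply (hasDerivAt_const φ v)).deriv.trans (by simp)

theorem norm_applyVec_le (T : CkCircle k (X →L[ℝ] E)) (v : X) : ‖T.applyVec v‖ ≤ ‖T‖ * ‖v‖ := by
  refine norm_le_of_iteratedDeriv_le _ (by positivity) fun j hj φ => ?_
  rw [iteratedDeriv_applyVec T v hj]
  exact (ContinuousLinearMap.le_opNorm _ v).trans
    (mul_le_mul_of_nonneg_right (T.norm_iteratedDeriv_le hj φ) (norm_nonneg v))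

variable (X E k) in
/-- The natural map `C^k(S¹; L(X, E)) → L(X, C^k(S¹; E))`. -/
def applyCLM : CkCircle k (X →L[ℝ] E) →L[ℝ] (X →L[ℝ] CkCircle k E) :=
  LinearMap.mkContinuous₂
    (LinearMap.mk₂ ℝ applyVec (fun _ _ _ => rfl) (fun _ _ _ => rfl)
      (fun T v w => ext fun φ => (T φ).map_add v w) (fun c T v => ext fun φ => (T φ).map_smul c v))
    1 (fun T v => by rw [one_mul]; exact norm_applyVec_le T v)

@[simp]
theorem applyCLM_apply (T : CkCircle k (X →L[ℝ] E)) (v : X) (φ : ℝ) :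
    applyCLM X E k T v φ = T φ v := rfl

end ApplyCLM

section ExponentialLaw

-- The induction on `ℓ` replaces `E` by `X →L[ℝ] E`, so both spaces live in one universe.
universe u

variable {X E : Type u} [NormedAddCommGroup X] [NormedSpace ℝ X]
  [NormedAddCommGroup E] [NormedSpace ℝ E] {k : ℕ} {V : Set X} {F : X → ℝ → E}

theorem exists_eq_of_contDiffOn_uncurry (hp : ∀ x ∈ V, Function.Periodic (F x) (2 * π))
    (hF : ContDiffOn ℝ k (Function.uncurry F) (V ×ˢ univ)) :
    ∃ J : X → CkCircle k E, ∀ x ∈ V, ∀ φ, J x φ = F x φ := by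
  classical
  refine ⟨fun x => if hx : x ∈ V then
    .ofPeriodic (F x) (hp x hx) (contDiff_of_contDiffOn_uncurry hF hx) else 0, fun x hx φ => ?_⟩
  simp only [hx, dif_pos, coe_ofPeriodic]

theorem continuousOn_of_contDiffOn_uncurry (hV : IsOpen V)
    (hF : ContDiffOn ℝ k (Function.uncurry F) (V ×ˢ univ)) {J : X → CkCircle k E}
    (hJ : ∀ x ∈ V, ∀ φ, J x φ = F x φ) : ContinuousOn J V := by
  intro x hx
  rw [ContinuousWithinAt, Metric.tendsto_nhds]
  intro ε hε
  have hclose : ∀ᶠ y in 𝓝[V] x, ∀ j : Fin (k + 1), ∀ φ ∈ Icc 0 (2 * π),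
      dist (iteratedDeriv j (F y) φ) (iteratedDeriv j (F x) φ) < ε / 2 :=
    Filter.eventually_all.2 fun j => eventually_dist_iteratedDeriv_lt
      (Nat.lt_succ_iff.mp j.2) hV hF hx isCompact_Icc (half_pos hε)
  filter_upwards [hclose, self_mem_nhdsWithin] with y hy hyV
  have hFJ : ∀ z ∈ V, F z = J z := fun z hz => funext fun φ => (hJ z hz φ).symm
  rw [hFJ x hx, hFJ y hyV] at hy
  rw [dist_eq_norm]
  refine (norm_le_of_iteratedDeriv_le _ (half_pos hε).le fun j hj φ => ?_).trans_lt
    (half_lt_self hε)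
  obtain ⟨ψ, hψ, hφψ⟩ := ((J y - J x).periodic_iteratedDeriv j).exists_mem_Ico₀ (by positivity) φ
  rw [hφψ, ← evJet_apply hj, map_sub, ← dist_eq_norm]
  exact (hy ⟨j, Nat.lt_succ_of_le hj⟩ ψ (Ico_subset_Icc_self hψ)).le

theorem exists_fderiv_of_contDiffOn_uncurry (hV : IsOpen V) {n : ℕ}
    (hF : ContDiffOn ℝ (n + 1) (Function.uncurry F) (V ×ˢ univ))
    (hp : ∀ x ∈ V, Function.Periodic (F x) (2 * π)) :
    ∃ F' : X → ℝ → (X →L[ℝ] E), ContDiffOn ℝ n (Function.uncurry F') (V ×ˢ univ) ∧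
      (∀ x ∈ V, ∀ φ, HasFDerivAt (fun x => F x φ) (F' x φ) x) ∧
      ∀ x ∈ V, Function.Periodic (F' x) (2 * π) := by
  let F' : X → ℝ → (X →L[ℝ] E) := fun x φ =>
    fderiv ℝ (Function.uncurry F) (x, φ) ∘L ContinuousLinearMap.inl ℝ X ℝ
  have hd : ∀ x ∈ V, ∀ φ, HasFDerivAt (fun x => F x φ) (F' x φ) x := fun x hx φ =>
    (hasFDerivAt_of_contDiffOn_uncurry (by simp) hV hF hx φ).comp (f := fun x => (x, φ)) x
      (hasFDerivAt_prodMk_left x φ)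
  refine ⟨F', ?_, hd, fun x hx φ => ?_⟩
  · exact (hF.fderiv_of_isOpen (hV.prod isOpen_univ) le_rfl).clm_comp contDiffOn_const
  · refine (hd x hx (φ + 2 * π)).unique ((hd x hx φ).congr_of_eventuallyEq ?_)
    filter_upwards [hV.mem_nhds hx] with y hy using hp y hy φ

theorem contDiffOn_of_contDiffOn_uncurry [CompleteSpace E] (ℓ : ℕ) (hV : IsOpen V)
    (hF : ContDiffOn ℝ (k + ℓ : ℕ) (Function.uncurry F) (V ×ˢ univ)) {J : X → CkCircle k E}
    (hJ : ∀ x ∈ V, ∀ φ, J x φ = F x φ) : ContDiffOn ℝ ℓ J V := by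
  induction ℓ generalizing E with
  | zero => exact contDiffOn_zero.2 (continuousOn_of_contDiffOn_uncurry hV hF hJ)
  | succ ℓ ih =>
    obtain ⟨F', hF', hd, hp'⟩ := exists_fderiv_of_contDiffOn_uncurry hV
      (n := k + ℓ) (by exact_mod_cast hF) fun x hx φ => by
        rw [← hJ x hx, ← hJ x hx, (J x).periodic φ]
    obtain ⟨J', hJ'⟩ := exists_eq_of_contDiffOn_uncurry (k := k) hp'
      (hF'.of_le (by exact_mod_cast Nat.le_add_right k ℓ))
    have hA : ContDiffOn ℝ ℓ (fun x => applyCLM X E k (J' x)) V :=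
      (applyCLM X E k).contDiff.comp_contDiffOn (ih hF' hJ')
    have hJd : ∀ x ∈ V, HasFDerivAt J (applyCLM X E k (J' x)) x := fun x hx => by
      refine hasFDerivAt_of_separating (ev := evJet (Nat.zero_le k)) (fun f g h => ext fun φ => ?_)
        (fun y hy φ => ?_) hA.continuousOn hV hx
      · simpa only [evJet_zero_apply] using h φ
      · have hF'J' : evJet (Nat.zero_le k) φ ∘L applyCLM X E k (J' y) = F' y φ := by
          ext v
          rw [ContinuousLinearMap.comp_apply, evJet_zero_apply, applyCLM_apply, hJ' y hy]
        rw [hF'J']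
        refine (hd y hy φ).congr_of_eventuallyEq ?_
        filter_upwards [hV.mem_nhds hy] with z hz
        rw [evJet_zero_apply, hJ z hz]
    push_cast
    rw [contDiffOn_succ_iff_fderiv_of_isOpen hV]
    exact ⟨fun x hx => (hJd x hx).differentiableAt.differentiableWithinAt, by simp,
      hA.congr fun x hx => (hJd x hx).fderiv⟩

theorem exists_contDiffOn_eq_of_contDiffOn_uncurry [CompleteSpace E] (ℓ : ℕ) (hV : IsOpen V)
    (hp : ∀ x ∈ V, Function.Periodic (F x) (2 * π))
    (hF : ContDiffOn ℝ (k + ℓ : ℕ) (Function.uncurry F) (V ×ˢ univ)) :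
    ∃ J : X → CkCircle k E, (∀ x ∈ V, ∀ φ, J x φ = F x φ) ∧ ContDiffOn ℝ ℓ J V := by
  obtain ⟨J, hJ⟩ := exists_eq_of_contDiffOn_uncurry (k := k) hp
    (hF.of_le (by exact_mod_cast Nat.le_add_right k ℓ))
  exact ⟨J, hJ, contDiffOn_of_contDiffOn_uncurry ℓ hV hF hJ⟩

end ExponentialLaw

end CkCircle

/-! ### The cross product of the plane -/

theorem inner_eq (v w : Plane) : ⟪v, w⟫ = v 0 * w 0 + v 1 * w 1 := by
  simp only [PiLp.inner_apply, Fin.sum_univ_two, RCLike.inner_apply, conj_trivial, mul_comm]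

theorem norm_sq_eq (v : Plane) : ‖v‖ ^ 2 = v 0 ^ 2 + v 1 ^ 2 := by
  simp only [EuclideanSpace.norm_sq_eq, Fin.sum_univ_two, Real.norm_eq_abs, sq_abs]

theorem abs_mul_sub_mul_le (v w : Plane) : |v 0 * w 1 - v 1 * w 0| ≤ ‖v‖ * ‖w‖ := by
  refine abs_le_of_sq_le_sq ?_ (by positivity)
  rw [mul_pow, norm_sq_eq, norm_sq_eq]
  linarith [sq_nonneg (v 0 * w 0 + v 1 * w 1)]

/-- The cross product `v₀w₁ - v₁w₀` of plane vectors, as a continuous bilinear form. It equals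
`⟪v, w^⊥⟫`, and it is positive when `w` points to the left of `v`. -/
def cross : Plane →L[ℝ] Plane →L[ℝ] ℝ :=
  LinearMap.mkContinuous₂
    (LinearMap.mk₂ ℝ (fun v w => v 0 * w 1 - v 1 * w 0)
      (fun u v w => by simp only [PiLp.add_apply]; ring)
      (fun c v w => by simp only [PiLp.smul_apply, smul_eq_mul]; ring)
      (fun u v w => by simp only [PiLp.add_apply]; ring)
      (fun c v w => by simp only [PiLp.smul_apply, smul_eq_mul]; ring))
    1 (fun v w => by rw [one_mul]; exact abs_mul_sub_mul_le v w)

theorem cross_apply (v w : Plane) : cross v w = v 0 * w 1 - v 1 * w 0 := rfl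

theorem norm_cross_le : ‖cross‖ ≤ 1 := LinearMap.mkContinuous₂_norm_le _ zero_le_one _

theorem inner_perp (v w : Plane) : ⟪v, perp w⟫ = cross v w := by
  rw [inner_eq, cross_apply]
  simp only [perp, Matrix.cons_val_zero, Matrix.cons_val_one]
  ring

theorem cross_self (v : Plane) : cross v v = 0 := by
  rw [cross_apply]
  ring

theorem cross_swap (v w : Plane) : cross v w = -cross w v := by
  rw [cross_apply, cross_apply]
  ring

theorem cross_sq_add_inner_sq (v w : Plane) : cross v w ^ 2 + ⟪v, w⟫ ^ 2 = ‖v‖ ^ 2 * ‖w‖ ^ 2 := by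
  rw [norm_sq_eq, norm_sq_eq, inner_eq, cross_apply]
  ring

theorem inner_mul_cross_sub (e v w : Plane) :
    ⟪e, v⟫ * cross e w - ⟪e, w⟫ * cross e v = ‖e‖ ^ 2 * cross v w := by
  simp only [norm_sq_eq, inner_eq, cross_apply]
  ring

/-! ### The round circle -/

section Circle

variable (n : ℕ) (R s t : ℝ)

theorem circleCurve_eq (φ : ℝ) : circleCurve n R φ = !₂[R * Real.cos φ, R * Real.sin φ] := rfl

theorem deriv_circleCurve (φ : ℝ) :
    deriv (circleCurve n R) φ = !₂[-(R * Real.sin φ), R * Real.cos φ] := by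
  have h : HasDerivAt (fun φ => ![R * Real.cos φ, R * Real.sin φ])
      ![-(R * Real.sin φ), R * Real.cos φ] φ := by
    refine hasDerivAt_pi.2 fun i => ?_
    fin_cases i
    · simpa using (Real.hasDerivAt_cos φ).const_mul R
    · simpa using (Real.hasDerivAt_sin φ).const_mul R
  exact ((EuclideanSpace.equiv (Fin 2) ℝ).symm.hasFDerivAt.comp_hasDerivAt φ h).deriv

theorem cross_deriv_circleCurve :
    cross (deriv (circleCurve n R) s) (circleCurve n R t - circleCurve n R s)
      = R ^ 2 * (1 - Real.cos (t - s)) := by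
  simp only [deriv_circleCurve, cross_apply, PiLp.sub_apply, circleCurve_eq,
    Matrix.cons_val_zero, Matrix.cons_val_one, Real.cos_sub]
  linear_combination R ^ 2 * Real.sin_sq_add_cos_sq s

theorem inner_deriv_circleCurve :
    ⟪deriv (circleCurve n R) t, circleCurve n R t - circleCurve n R s⟫
      = R ^ 2 * Real.sin (t - s) := by
  simp only [deriv_circleCurve, inner_eq, PiLp.sub_apply, circleCurve_eq,
    Matrix.cons_val_zero, Matrix.cons_val_one, Real.sin_sub]
  ring

theorem dist_circleCurve :
    dist (circleCurve n R t) (circleCurve n R s) = |2 * R * Real.sin ((t - s) / 2)| := by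
  rw [dist_eq_norm, ← abs_norm, ← sq_eq_sq_iff_abs_eq_abs, norm_sq_eq, mul_pow,
    Real.sin_sq_eq_half_sub, mul_div_cancel₀ _ two_ne_zero, Real.cos_sub]
  simp only [PiLp.sub_apply, circleCurve_eq, Matrix.cons_val_zero, Matrix.cons_val_one]
  linear_combination R ^ 2 * Real.sin_sq_add_cos_sq s + R ^ 2 * Real.sin_sq_add_cos_sq t

end Circle

theorem sin_div_mul_sq_le {x y : ℝ} (hx : 0 < x) (hxπ : x ≤ π) (hy : |y| ≤ x) :
    Real.sin x / x * y ^ 2 ≤ y * Real.sin y := by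
  have hsecant : |y| / x * Real.sin x ≤ Real.sin |y| := by
    have h := strictConcaveOn_sin_Icc.concaveOn.2 (left_mem_Icc.2 Real.pi_pos.le) ⟨hx.le, hxπ⟩
      (sub_nonneg.2 ((div_le_one hx).2 hy)) (by positivity : 0 ≤ |y| / x) (by ring)
    simpa [div_mul_cancel₀ _ hx.ne'] using h
  have habs : y * Real.sin y = |y| * Real.sin |y| := by
    rcases abs_choice y with h | h <;> rw [h]
    rw [Real.sin_neg, neg_mul_neg]
  calc Real.sin x / x * y ^ 2 = |y| * (|y| / x * Real.sin x) := by rw [← sq_abs]; ring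
    _ ≤ |y| * Real.sin |y| := mul_le_mul_of_nonneg_left hsecant (abs_nonneg y)
    _ = y * Real.sin y := habs.symm

theorem exists_lt_two_mul_sin_half {r R : ℝ} (hR : r / 2 < R) :
    ∃ x, 0 < x ∧ x < π ∧ r < 2 * R * Real.sin (x / 2) := by
  have hcont : Continuous fun x => 2 * R * Real.sin (x / 2) := by fun_prop
  have hlim : Filter.Tendsto (fun x => 2 * R * Real.sin (x / 2)) (𝓝[<] π) (𝓝 (2 * R)) :=
    (hcont.tendsto' π (2 * R) (by simp)).mono_left nhdsWithin_le_nhds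
  obtain ⟨x, hx, hx0, hxπ⟩ := ((hlim.eventually_const_lt (show r < 2 * R by linarith)).and
    (Ioo_mem_nhdsLT Real.pi_pos)).exists
  exact ⟨x, hx0, hxπ, hx⟩

theorem abs_bilin_sub_le {E F : Type*} [NormedAddCommGroup E] [NormedSpace ℝ E]
    [NormedAddCommGroup F] [NormedSpace ℝ F] {B : E →L[ℝ] F →L[ℝ] ℝ} (hB : ‖B‖ ≤ 1) {u u' : E}
    {v v' : F} {a a' d K : ℝ} (hu : ‖u‖ ≤ a) (hv' : ‖v'‖ ≤ a' * K) (hud : ‖u' - u‖ ≤ d)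
    (hvd : ‖v' - v‖ ≤ d * K) : |B u' v' - B u v| ≤ (a + a') * d * K := by
  have hle : ∀ x y, |B x y| ≤ ‖x‖ * ‖y‖ := fun x y => (B.le_opNorm₂ x y).trans (by
    rw [mul_assoc]; exact mul_le_of_le_one_left (by positivity) hB)
  have ha : 0 ≤ a := (norm_nonneg u).trans hu
  have hd : 0 ≤ d := (norm_nonneg _).trans hud
  calc |B u' v' - B u v| = |B (u' - u) v' + B u (v' - v)| := by
        simp only [map_sub, sub_apply, sub_add_sub_cancel]
    _ ≤ ‖u' - u‖ * ‖v'‖ + ‖u‖ * ‖v' - v‖ :=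
        (abs_add_le _ _).trans (add_le_add (hle _ _) (hle _ _))
    _ ≤ d * (a' * K) + a * (d * K) := by gcongr
    _ = (a + a') * d * K := by ring

/-! ### Curves near the circle -/

/-- A closed curve which shares with the circle those features that matter for its intersections
with the circles of radius `r` around its points: it lies strictly to the left of each of its
tangents, the distance from `γ φ` is strictly monotone as long as the parameter distance from `φ`
is at most `x₁`, and exceeds `r` beyond. -/
structure NearCircle (r x₁ : ℝ) (γ : ℝ → Plane) : Prop where
  r_pos : 0 < r
  pos : 0 < x₁
  lt_pi : x₁ < π
  periodic : Function.Periodic γ (2 * π)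
  contDiff : ContDiff ℝ 1 γ
  cross_pos : ∀ φ, ∀ ψ ∈ Ioo φ (φ + 2 * π), 0 < cross (deriv γ φ) (γ ψ - γ φ)
  inner_pos : ∀ φ, ∀ ψ ∈ Ioc φ (φ + x₁), 0 < ⟪deriv γ ψ, γ ψ - γ φ⟫
  inner_neg : ∀ φ, ∀ ψ ∈ Ico (φ - x₁) φ, ⟪deriv γ ψ, γ ψ - γ φ⟫ < 0
  lt_dist : ∀ φ, ∀ ψ ∈ Icc (φ + x₁) (φ + 2 * π - x₁), r < dist (γ ψ) (γ φ)

section Neighbourhood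

variable {n : ℕ} {R : ℝ} {c γ : CkCircle n Plane} {s t : ℝ}

theorem CkCircle.abs_cross_deriv_sub_le (hn : 2 ≤ n) (c γ : CkCircle n Plane) (s t : ℝ) :
    |cross (deriv γ s) (γ t - γ s) - cross (deriv c s) (c t - c s)|
      ≤ (‖c‖ + ‖γ‖) * ‖γ - c‖ * (t - s) ^ 2 := by
  have hn1 : 1 ≤ n := one_le_two.trans hn
  have hremainder : ∀ f : CkCircle n Plane, cross (deriv f s) (f t - f s)
      = cross (deriv f s) (f t - f s - (t - s) • deriv f s) := fun f => by
    rw [map_sub _ (f t - f s), map_smul, cross_self, smul_zero, sub_zero]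
  have hderiv := CkCircle.deriv_sub hn1 γ c s
  rw [hremainder γ, hremainder c]
  refine abs_bilin_sub_le norm_cross_le (c.norm_deriv_le hn1 s) (γ.norm_taylor_le hn s t) ?_ ?_
  · exact hderiv ▸ (γ - c).norm_deriv_le hn1 s
  · convert (γ - c).norm_taylor_le hn s t using 2
    rw [hderiv, CkCircle.sub_apply, CkCircle.sub_apply, smul_sub]
    abel

theorem CkCircle.abs_inner_deriv_sub_le (hn : 1 ≤ n) (c γ : CkCircle n Plane) (s t : ℝ) :
    |⟪deriv γ t, γ t - γ s⟫ - ⟪deriv c t, c t - c s⟫|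
      ≤ (‖c‖ + ‖γ‖) * ‖γ - c‖ * |t - s| := by
  refine abs_bilin_sub_le (norm_innerSL_le ℝ) (c.norm_deriv_le hn t) (γ.norm_sub_le hn s t) ?_ ?_
  · exact CkCircle.deriv_sub hn γ c t ▸ (γ - c).norm_deriv_le hn t
  · convert (γ - c).norm_sub_le hn s t using 2
    rw [CkCircle.sub_apply, CkCircle.sub_apply]
    abel

theorem cross_deriv_pos_of_abs_le (hn : 2 ≤ n)
    (hγ : (‖circleCurve n R‖ + ‖γ‖) * ‖γ - circleCurve n R‖ < R ^ 2 * (2 / π ^ 2))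
    (hst : |t - s| ≤ π) (hne : t ≠ s) : 0 < cross (deriv γ s) (γ t - γ s) := by
  have hperturb := (abs_le.1 ((circleCurve n R).abs_cross_deriv_sub_le hn γ s t)).1
  have hcircle : R ^ 2 * (2 / π ^ 2) * (t - s) ^ 2 ≤ R ^ 2 * (1 - Real.cos (t - s)) := by
    rw [mul_assoc]
    exact mul_le_mul_of_nonneg_left (by linarith [Real.cos_le_one_sub_mul_cos_sq hst])
      (sq_nonneg R)
  rw [cross_deriv_circleCurve] at hperturb
  linarith [mul_lt_mul_of_pos_right hγ (sq_pos_of_ne_zero (sub_ne_zero.2 hne))]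

theorem cross_deriv_pos (hn : 2 ≤ n)
    (hγ : (‖circleCurve n R‖ + ‖γ‖) * ‖γ - circleCurve n R‖ < R ^ 2 * (2 / π ^ 2))
    (ht : t ∈ Ioo s (s + 2 * π)) : 0 < cross (deriv γ s) (γ t - γ s) := by
  obtain ⟨hst, hts⟩ := ht
  rcases le_or_gt (t - s) π with h | h
  · exact cross_deriv_pos_of_abs_le hn hγ (by rwa [abs_of_pos (sub_pos.2 hst)]) hst.ne'
  · rw [← γ.periodic.sub_eq t]
    exact cross_deriv_pos_of_abs_le hn hγ (abs_le.2 ⟨by linarith, by linarith⟩) (by linarith)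

theorem mul_inner_deriv_pos (hn : 1 ≤ n) {x : ℝ} (hx : 0 < x) (hxπ : x ≤ π)
    (hγ : (‖circleCurve n R‖ + ‖γ‖) * ‖γ - circleCurve n R‖ < R ^ 2 * (Real.sin x / x))
    (hst : |t - s| ≤ x) (hne : t ≠ s) : 0 < (t - s) * ⟪deriv γ t, γ t - γ s⟫ := by
  have hperturb := mul_le_mul_of_nonneg_left
    ((circleCurve n R).abs_inner_deriv_sub_le hn γ s t) (abs_nonneg (t - s))
  have hcircle := mul_le_mul_of_nonneg_left (sin_div_mul_sq_le hx hxπ hst) (sq_nonneg R)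
  rw [← abs_mul, inner_deriv_circleCurve, mul_left_comm, abs_mul_abs_self, ← sq] at hperturb
  linarith [(abs_le.1 hperturb).1,
    mul_lt_mul_of_pos_right hγ (sq_pos_of_ne_zero (sub_ne_zero.2 hne))]

theorem lt_dist_of_mem_Icc {r x : ℝ} (hR : 0 ≤ R) (hx : 0 ≤ x)
    (hγ : r + 2 * ‖γ - circleCurve n R‖ < 2 * R * Real.sin (x / 2))
    (ht : t ∈ Icc (s + x) (s + 2 * π - x)) : r < dist (γ t) (γ s) := by
  have hsin : Real.sin (x / 2) ≤ Real.sin ((t - s) / 2) := by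
    obtain ⟨hst, hts⟩ := ht
    rcases le_total (t - s) π with h | h
    · exact Real.sin_le_sin_of_le_of_le_pi_div_two (by linarith [Real.pi_pos]) (by linarith)
        (by linarith)
    · rw [← Real.sin_pi_sub ((t - s) / 2)]
      exact Real.sin_le_sin_of_le_of_le_pi_div_two (by linarith [Real.pi_pos]) (by linarith)
        (by linarith)
  have hcircle : 2 * R * Real.sin (x / 2) ≤ dist (circleCurve n R t) (circleCurve n R s) := by
    rw [dist_circleCurve]
    exact (mul_le_mul_of_nonneg_left hsin (by positivity)).trans (le_abs_self _)
  have hclose : ∀ φ, dist (circleCurve n R φ) (γ φ) ≤ ‖γ - circleCurve n R‖ := fun φ => by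
    rw [dist_eq_norm_sub']
    simpa only [iteratedDeriv_zero, CkCircle.sub_apply] using
      (γ - circleCurve n R).norm_iteratedDeriv_le (Nat.zero_le n) φ
  have htriangle := dist_triangle4_right (circleCurve n R t) (circleCurve n R s) (γ t) (γ s)
  linarith [hclose s, hclose t]

theorem nearCircle_of_norm_sub_lt (hn : 2 ≤ n) {r x : ℝ} (hr : 0 < r) (hR : 0 ≤ R) (hx : 0 < x)
    (hxπ : x < π)
    (hcross : (‖circleCurve n R‖ + ‖γ‖) * ‖γ - circleCurve n R‖ < R ^ 2 * (2 / π ^ 2))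
    (hinner : (‖circleCurve n R‖ + ‖γ‖) * ‖γ - circleCurve n R‖ < R ^ 2 * (Real.sin x / x))
    (hdist : r + 2 * ‖γ - circleCurve n R‖ < 2 * R * Real.sin (x / 2)) : NearCircle r x γ where
  r_pos := hr
  pos := hx
  lt_pi := hxπ
  periodic := γ.periodic
  contDiff := γ.contDiff.of_le (by exact_mod_cast one_le_two.trans hn)
  cross_pos _ _ hψ := cross_deriv_pos hn hcross hψ
  inner_pos φ ψ hψ := (mul_pos_iff_of_pos_left (sub_pos.2 hψ.1)).1
    (mul_inner_deriv_pos (one_le_two.trans hn) hx hxπ.le hinner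
      (abs_le.2 ⟨by linarith [hψ.1], by linarith [hψ.2]⟩) hψ.1.ne')
  inner_neg φ ψ hψ := (neg_iff_neg_of_mul_pos (mul_inner_deriv_pos (one_le_two.trans hn) hx
    hxπ.le hinner (abs_le.2 ⟨by linarith [hψ.1], by linarith [hψ.2]⟩) hψ.2.ne)).1
      (sub_neg.2 hψ.2)
  lt_dist _ _ hψ := lt_dist_of_mem_Icc hR hx.le hdist hψ

theorem exists_eventually_nearCircle (hn : 2 ≤ n) {r : ℝ} (hr : 0 < r) (hR : r / 2 < R) :
    ∃ x, ∀ᶠ γ : CkCircle n Plane in 𝓝 (circleCurve n R), NearCircle r x γ := by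
  have hR0 : 0 < R := by linarith
  obtain ⟨x, hx, hxπ, hrx⟩ := exists_lt_two_mul_sin_half hR
  have hsin : 0 < Real.sin x := Real.sin_pos_of_pos_of_lt_pi hx hxπ
  have hprod : Continuous fun γ : CkCircle n Plane =>
    (‖circleCurve n R‖ + ‖γ‖) * ‖γ - circleCurve n R‖ := by fun_prop
  have hdist : Continuous fun γ : CkCircle n Plane => r + 2 * ‖γ - circleCurve n R‖ := by fun_prop
  refine ⟨x, ?_⟩
  filter_upwards [(hprod.tendsto' _ 0 (by simp)).eventually_lt_const
      (show 0 < R ^ 2 * (2 / π ^ 2) by positivity),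
    (hprod.tendsto' _ 0 (by simp)).eventually_lt_const
      (show 0 < R ^ 2 * (Real.sin x / x) by positivity),
    (hdist.tendsto' _ r (by simp)).eventually_lt_const hrx] with γ h₁ h₂ h₃
  exact nearCircle_of_norm_sub_lt hn hr hR0.le hx hxπ h₁ h₂ h₃

end Neighbourhood

/-! ### Chords and intersection parameters -/

theorem hasDerivAt_dist_sq {γ : ℝ → Plane} {γ' : Plane} {ψ : ℝ} (hγ : HasDerivAt γ γ' ψ)
    (q : Plane) : HasDerivAt (fun ψ => dist (γ ψ) q ^ 2) (2 * ⟪γ', γ ψ - q⟫) ψ := by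
  simp only [dist_eq_norm]
  rw [real_inner_comm]
  exact (hγ.sub_const q).norm_sq

namespace NearCircle

variable {r x₁ : ℝ} {γ : ℝ → Plane} (h : NearCircle r x₁ γ)

include h

theorem hasDerivAt (φ : ℝ) : HasDerivAt γ (deriv γ φ) φ :=
  (h.contDiff.differentiable one_ne_zero φ).hasDerivAt

theorem continuous : Continuous γ := h.contDiff.continuous

theorem continuous_deriv : Continuous (deriv γ) := h.contDiff.continuous_deriv le_rfl

theorem cross_deriv_right_pos {a b : ℝ} (hab : a < b) (hb : b < a + 2 * π) :
    0 < cross (deriv γ b) (γ a - γ b) := by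
  have := h.cross_pos b (a + 2 * π) ⟨hb, by linarith⟩
  rwa [h.periodic] at this

theorem isEmbedded : IsEmbedded γ := by
  have hne : ∀ a ∈ Ico 0 (2 * π), ∀ b ∈ Ico 0 (2 * π), a < b → γ a ≠ γ b := by
    intro a ha b hb hab heq
    have := h.cross_pos a b ⟨hab, by linarith [ha.1, hb.2]⟩
    rw [heq, sub_self, map_zero] at this
    exact this.false
  intro a ha b hb heq
  rcases lt_trichotomy a b with hab | hab | hab
  · exact absurd heq (hne a ha b hb hab)
  · exact hab
  · exact absurd heq.symm (hne b hb a ha hab)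

theorem strictAntiOn_inner_div_cross (a : ℝ) :
    StrictAntiOn (fun t => ⟪deriv γ a, γ t - γ a⟫ / cross (deriv γ a) (γ t - γ a))
      (Ioo a (a + 2 * π)) := by
  set e := deriv γ a
  have hquot : ∀ t ∈ Ioo a (a + 2 * π),
      HasDerivAt (fun t => ⟪e, γ t - γ a⟫ / cross e (γ t - γ a))
        (‖e‖ ^ 2 * cross (deriv γ t) (γ t - γ a) / cross e (γ t - γ a) ^ 2) t := fun t ht => by
    have hchord := (h.hasDerivAt t).sub_const (γ a)
    rw [← inner_mul_cross_sub]
    exact ((innerSL ℝ e).hasFDerivAt.comp_hasDerivAt t hchord).div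
      ((cross e).hasFDerivAt.comp_hasDerivAt t hchord) (h.cross_pos a t ht).ne'
  refine strictAntiOn_of_deriv_neg (convex_Ioo _ _)
    (fun t ht => (hquot t ht).continuousAt.continuousWithinAt) fun t ht => ?_
  rw [interior_Ioo] at ht
  have hleft : 0 < cross e (γ t - γ a) := h.cross_pos a t ht
  have he : e ≠ 0 := by
    rintro he
    simp [he] at hleft
  have hright := h.cross_deriv_right_pos ht.1 ht.2
  rw [← neg_sub, map_neg, neg_pos] at hright
  rw [(hquot t ht).deriv]
  exact div_neg_of_neg_of_pos (mul_neg_of_pos_of_neg (by positivity) hright) (by positivity)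

theorem cross_chords_pos {a b c : ℝ} (hab : a < b) (hbc : b < c) (hc : c < a + 2 * π) :
    0 < cross (γ b - γ a) (γ c - γ a) := by
  have hb : b ∈ Ioo a (a + 2 * π) := ⟨hab, hbc.trans hc⟩
  have hc : c ∈ Ioo a (a + 2 * π) := ⟨hab.trans hbc, hc⟩
  have hquot := h.strictAntiOn_inner_div_cross a hb hc hbc
  rw [div_lt_div_iff₀ (h.cross_pos a c hc) (h.cross_pos a b hb), ← sub_pos,
    inner_mul_cross_sub] at hquot
  exact pos_of_mul_pos_right hquot (sq_nonneg _)

theorem strictMonoOn_dist (φ : ℝ) :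
    StrictMonoOn (fun ψ => dist (γ ψ) (γ φ)) (Icc φ (φ + x₁)) := by
  have hsq : StrictMonoOn (fun ψ => dist (γ ψ) (γ φ) ^ 2) (Icc φ (φ + x₁)) := by
    refine strictMonoOn_of_deriv_pos (convex_Icc _ _)
      (h.continuous.dist continuous_const |>.pow 2).continuousOn fun ψ hψ => ?_
    rw [interior_Icc] at hψ
    rw [(hasDerivAt_dist_sq (h.hasDerivAt ψ) (γ φ)).deriv]
    exact mul_pos two_pos (h.inner_pos φ ψ (Ioo_subset_Ioc_self hψ))
  exact fun ψ hψ χ hχ hlt => lt_of_pow_lt_pow_left₀ 2 dist_nonneg (hsq hψ hχ hlt)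

theorem strictAntiOn_dist (φ : ℝ) :
    StrictAntiOn (fun ψ => dist (γ ψ) (γ φ)) (Icc (φ - x₁) φ) := by
  have hsq : StrictAntiOn (fun ψ => dist (γ ψ) (γ φ) ^ 2) (Icc (φ - x₁) φ) := by
    refine strictAntiOn_of_deriv_neg (convex_Icc _ _)
      (h.continuous.dist continuous_const |>.pow 2).continuousOn fun ψ hψ => ?_
    rw [interior_Icc] at hψ
    rw [(hasDerivAt_dist_sq (h.hasDerivAt ψ) (γ φ)).deriv]
    exact mul_neg_of_pos_of_neg two_pos (h.inner_neg φ ψ (Ioo_subset_Ico_self hψ))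
  exact fun ψ hψ χ hχ hlt => lt_of_pow_lt_pow_left₀ 2 dist_nonneg (hsq hψ hχ hlt)

theorem exists_isLeast_dist_eq (φ : ℝ) :
    ∃ p ∈ Ioo φ (φ + x₁), IsLeast {ψ | φ < ψ ∧ dist (γ ψ) (γ φ) = r} p := by
  have hx₁ := h.pos
  have hcont : Continuous fun ψ => dist (γ ψ) (γ φ) := h.continuous.dist continuous_const
  obtain ⟨p, hp, hdist⟩ := intermediate_value_Ioo (by linarith : φ ≤ φ + x₁) hcont.continuousOn
    ⟨(dist_self (γ φ)).trans_lt h.r_pos, h.lt_dist φ _ ⟨le_rfl, by linarith [h.lt_pi]⟩⟩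
  refine ⟨p, hp, ⟨hp.1, hdist⟩, fun ψ hψ => not_lt.1 fun hlt => ?_⟩
  exact (h.strictMonoOn_dist φ ⟨hψ.1.le, (hlt.trans hp.2).le⟩ (Ioo_subset_Icc_self hp) hlt).ne
    (hψ.2.trans hdist.symm)

theorem exists_isGreatest_dist_eq (φ : ℝ) :
    ∃ m ∈ Ioo (φ - x₁) φ, IsGreatest {ψ | ψ < φ ∧ dist (γ ψ) (γ φ) = r} m := by
  have hx₁ := h.pos
  have hcont : Continuous fun ψ => dist (γ ψ) (γ φ) := h.continuous.dist continuous_const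
  have hend : r < dist (γ (φ - x₁)) (γ φ) := by
    rw [← h.periodic]
    exact h.lt_dist φ _ ⟨by linarith [h.lt_pi], by linarith⟩
  obtain ⟨m, hm, hdist⟩ := intermediate_value_Ioo' (by linarith : φ - x₁ ≤ φ) hcont.continuousOn
    ⟨(dist_self (γ φ)).trans_lt h.r_pos, hend⟩
  refine ⟨m, hm, ⟨hm.2, hdist⟩, fun ψ hψ => not_lt.1 fun hlt => ?_⟩
  exact (h.strictAntiOn_dist φ (Ioo_subset_Icc_self hm) ⟨(hm.1.trans hlt).le, hψ.1.le⟩ hlt).ne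
    (hψ.2.trans hdist.symm)

theorem nextParam_mem_Ioo (φ : ℝ) : nextParam r γ φ ∈ Ioo φ (φ + x₁) := by
  obtain ⟨p, hp, hleast⟩ := h.exists_isLeast_dist_eq φ
  rwa [nextParam, hleast.csInf_eq]

theorem prevParam_mem_Ioo (φ : ℝ) : prevParam r γ φ ∈ Ioo (φ - x₁) φ := by
  obtain ⟨m, hm, hgreatest⟩ := h.exists_isGreatest_dist_eq φ
  rwa [prevParam, hgreatest.csSup_eq]

theorem dist_nextParam (φ : ℝ) : dist (γ (nextParam r γ φ)) (γ φ) = r := by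
  obtain ⟨p, -, hleast⟩ := h.exists_isLeast_dist_eq φ
  rw [nextParam, hleast.csInf_eq]
  exact hleast.1.2

theorem dist_prevParam (φ : ℝ) : dist (γ (prevParam r γ φ)) (γ φ) = r := by
  obtain ⟨m, -, hgreatest⟩ := h.exists_isGreatest_dist_eq φ
  rw [prevParam, hgreatest.csSup_eq]
  exact hgreatest.1.2

theorem nextParam_lt (φ : ℝ) : nextParam r γ φ < prevParam r γ φ + 2 * π := by
  linarith [(h.nextParam_mem_Ioo φ).2, (h.prevParam_mem_Ioo φ).1, h.lt_pi]

theorem dist_lt_of_mem_Ico_nextParam {φ ψ : ℝ} (hψ : ψ ∈ Ico φ (nextParam r γ φ)) :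
    dist (γ ψ) (γ φ) < r := by
  have hp := h.nextParam_mem_Ioo φ
  exact (h.strictMonoOn_dist φ ⟨hψ.1, (hψ.2.trans hp.2).le⟩ (Ioo_subset_Icc_self hp) hψ.2).trans_eq
    (h.dist_nextParam φ)

theorem dist_lt_of_mem_Ioc_prevParam {φ ψ : ℝ} (hψ : ψ ∈ Ioc (prevParam r γ φ) φ) :
    dist (γ ψ) (γ φ) < r := by
  have hm := h.prevParam_mem_Ioo φ
  exact (h.strictAntiOn_dist φ (Ioo_subset_Icc_self hm) ⟨(hm.1.trans hψ.1).le, hψ.2⟩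
    hψ.1).trans_eq (h.dist_prevParam φ)

theorem lt_dist_of_mem_Ioo {φ ψ : ℝ}
    (hψ : ψ ∈ Ioo (nextParam r γ φ) (prevParam r γ φ + 2 * π)) : r < dist (γ ψ) (γ φ) := by
  have hp := h.nextParam_mem_Ioo φ
  have hm := h.prevParam_mem_Ioo φ
  rcases le_total ψ (φ + x₁) with hnear | hfar
  · exact (h.dist_nextParam φ).symm.trans_lt (h.strictMonoOn_dist φ (Ioo_subset_Icc_self hp)
      ⟨(hp.1.trans hψ.1).le, hnear⟩ hψ.1)
  rcases le_total (φ + 2 * π - x₁) ψ with hnear | hfar'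
  · rw [← h.periodic.sub_eq ψ]
    exact (h.dist_prevParam φ).symm.trans_lt (h.strictAntiOn_dist φ
      ⟨by linarith, by linarith [hψ.2, hm.2]⟩ (Ioo_subset_Icc_self hm) (by linarith [hψ.2]))
  · exact h.lt_dist φ ψ ⟨hfar, hfar'⟩

theorem dist_le_of_mem_Icc {φ ψ : ℝ} (hψ : ψ ∈ Icc (prevParam r γ φ) (nextParam r γ φ)) :
    dist (γ ψ) (γ φ) ≤ r := by
  rcases hψ.1.eq_or_lt with rfl | hm
  · exact (h.dist_prevParam φ).le
  rcases hψ.2.eq_or_lt with rfl | hp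
  · exact (h.dist_nextParam φ).le
  rcases le_total φ ψ with hle | hle
  · exact (h.dist_lt_of_mem_Ico_nextParam ⟨hle, hp⟩).le
  · exact (h.dist_lt_of_mem_Ioc_prevParam ⟨hm, hle⟩).le

theorem le_dist_of_mem_Icc {φ ψ : ℝ}
    (hψ : ψ ∈ Icc (nextParam r γ φ) (prevParam r γ φ + 2 * π)) : r ≤ dist (γ ψ) (γ φ) := by
  rcases hψ.1.eq_or_lt with rfl | hp
  · exact (h.dist_nextParam φ).ge
  rcases hψ.2.eq_or_lt with rfl | hm
  · rw [h.periodic, h.dist_prevParam]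
  · exact (h.lt_dist_of_mem_Ioo ⟨hp, hm⟩).le

theorem meetsTwice (φ : ℝ) : MeetsTwice r γ φ := by
  have hp := h.nextParam_mem_Ioo φ
  have hm := h.prevParam_mem_Ioo φ
  have hlt := h.nextParam_lt φ
  refine ⟨Subset.antisymm ?_ ?_, hlt⟩
  · rintro ψ ⟨hψ, hdist⟩
    rcases lt_trichotomy ψ (nextParam r γ φ) with hlt | heq | hgt
    · exact absurd hdist (h.dist_lt_of_mem_Ico_nextParam ⟨hψ.1.le, hlt⟩).ne
    · exact Or.inl heq
    rcases lt_trichotomy ψ (prevParam r γ φ + 2 * π) with hlt' | heq | hgt'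
    · exact absurd hdist (h.lt_dist_of_mem_Ioo ⟨hgt, hlt'⟩).ne'
    · exact Or.inr heq
    · rw [← h.periodic.sub_eq ψ] at hdist
      exact absurd hdist (h.dist_lt_of_mem_Ioc_prevParam
        ⟨by linarith, by linarith [hψ.2]⟩).ne
  · rintro ψ (rfl | rfl)
    · exact ⟨⟨hp.1, by linarith [hm.2]⟩, h.dist_nextParam φ⟩
    · exact ⟨⟨by linarith [hp.1], by linarith [hm.2]⟩,
        (congrArg (dist · (γ φ)) (h.periodic _)).trans (h.dist_prevParam φ)⟩

theorem cross_next_prev_pos (φ : ℝ) :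
    0 < cross (γ (nextParam r γ φ) - γ φ) (γ (prevParam r γ φ) - γ φ) := by
  have := h.cross_chords_pos (h.nextParam_mem_Ioo φ).1 (h.nextParam_lt φ)
    (by linarith [(h.prevParam_mem_Ioo φ).2])
  rwa [h.periodic] at this

theorem inner_nextParam_pos (φ : ℝ) :
    0 < ⟪deriv γ (nextParam r γ φ), γ (nextParam r γ φ) - γ φ⟫ :=
  h.inner_pos φ _ (Ioo_subset_Ioc_self (h.nextParam_mem_Ioo φ))

theorem inner_prevParam_neg (φ : ℝ) :
    ⟪deriv γ (prevParam r γ φ), γ (prevParam r γ φ) - γ φ⟫ < 0 :=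
  h.inner_neg φ _ (Ioo_subset_Ico_self (h.prevParam_mem_Ioo φ))

theorem cross_sq_next_prev (φ : ℝ) :
    cross (γ (nextParam r γ φ) - γ φ) (γ (prevParam r γ φ) - γ φ) ^ 2 =
      r ^ 4 - ⟪γ (nextParam r γ φ) - γ φ, γ (prevParam r γ φ) - γ φ⟫ ^ 2 := by
  have := cross_sq_add_inner_sq (γ (nextParam r γ φ) - γ φ) (γ (prevParam r γ φ) - γ φ)
  rw [← dist_eq_norm, ← dist_eq_norm, h.dist_nextParam, h.dist_prevParam] at this
  linear_combination this

theorem nonDegenerate (φ : ℝ) : NonDegenerate r γ φ := by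
  refine ⟨(h.inner_nextParam_pos φ).ne', (h.inner_prevParam_neg φ).ne, ?_⟩
  rw [← h.cross_sq_next_prev]
  exact pow_pos (h.cross_next_prev_pos φ) 2

end NearCircle

/-! ### Areas of star-shaped regions -/

theorem lintegral_regionBetween {α : Type*} [MeasurableSpace α] {μ : Measure α} [SFinite μ]
    {f g : α → ℝ} {s : Set α} {F : α × ℝ → ENNReal} (hf : Measurable f) (hg : Measurable g)
    (hs : MeasurableSet s) (hF : Measurable F) :
    ∫⁻ z in regionBetween f g s, F z ∂μ.prod volume
      = ∫⁻ x in s, (∫⁻ y in Ioo (f x) (g x), F (x, y)) ∂μ := by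
  have hregion := measurableSet_regionBetween hf hg hs
  have hslice : ∀ x y, (regionBetween f g s).indicator F (x, y)
      = s.indicator (fun x => (Ioo (f x) (g x)).indicator (fun y => F (x, y)) y) x := fun x y => by
    by_cases hx : x ∈ s <;> simp [indicator, regionBetween, hx]
  rw [← lintegral_indicator hregion, lintegral_prod _ (hF.indicator hregion).aemeasurable,
    ← lintegral_indicator hs]
  refine lintegral_congr fun x => ?_
  simp only [hslice]
  by_cases hx : x ∈ s
  · simp only [indicator_of_mem hx, lintegral_indicator measurableSet_Ioo]
  · simp only [indicator_of_notMem hx, lintegral_zero]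

theorem lintegral_Ioo_ofReal_mul {T c : ℝ} (hT : 0 ≤ T) (hc : 0 ≤ c) :
    ∫⁻ s in Ioo 0 T, ENNReal.ofReal (s * c) = ENNReal.ofReal (T ^ 2 * c / 2) := by
  rw [← ofReal_integral_eq_lintegral_ofReal, ← integral_Ioc_eq_integral_Ioo,
    ← intervalIntegral.integral_of_le hT, intervalIntegral.integral_mul_const, integral_id]
  · congr 1
    ring
  · exact ((continuous_id.mul continuous_const).integrableOn_Icc).mono_set Ioo_subset_Icc_self
  · filter_upwards [ae_restrict_mem measurableSet_Ioo] with s hs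
    exact mul_nonneg hs.1.le hc

/-- The coordinates of a plane vector, as a pair of reals. -/
def coords : Plane ≃L[ℝ] ℝ × ℝ :=
  (EuclideanSpace.equiv (Fin 2) ℝ).trans (ContinuousLinearEquiv.finTwoArrow ℝ ℝ)

theorem measurePreserving_coords : MeasurePreserving coords volume volume :=
  (volume_preserving_finTwoArrow ℝ).comp (PiLp.volume_preserving_ofLp (Fin 2))

theorem volume_image_coords (A : Set Plane) : volume (coords '' A) = volume A := by
  rw [← measurePreserving_coords.measure_preimage_emb
    coords.toHomeomorph.measurableEmbedding, preimage_image_eq _ coords.injective]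

/-- Polar-type coordinates around `q`: the point at fraction `s` of the segment from `q` to
`q + w ψ`. -/
def sweep (q : Plane) (w : ℝ → Plane) (z : ℝ × ℝ) : Plane := q + z.2 • w z.1

/-- The differential of `sweep q w`. -/
def sweepFDeriv (w : ℝ → Plane) (z : ℝ × ℝ) : ℝ × ℝ →L[ℝ] Plane :=
  z.2 • (ContinuousLinearMap.fst ℝ ℝ ℝ).smulRight (deriv w z.1)
    + (ContinuousLinearMap.snd ℝ ℝ ℝ).smulRight (w z.1)

section Sweep

variable {q : Plane} {w : ℝ → Plane}

theorem contDiff_sweep {n : WithTop ℕ∞} (hw : ContDiff ℝ n w) : ContDiff ℝ n (sweep q w) :=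
  contDiff_const.add (contDiff_snd.smul (hw.comp contDiff_fst))

theorem hasFDerivAt_sweep {z : ℝ × ℝ} (hw : DifferentiableAt ℝ w z.1) :
    HasFDerivAt (sweep q w) (sweepFDeriv w z) z :=
  (hasFDerivAt_snd.smul (hw.hasDerivAt.hasFDerivAt.comp z hasFDerivAt_fst)).const_add q

theorem det_coords_comp_sweepFDeriv (w : ℝ → Plane) (z : ℝ × ℝ) :
    ((coords : Plane →L[ℝ] ℝ × ℝ) ∘L sweepFDeriv w z).det
      = -(z.2 * cross (w z.1) (deriv w z.1)) := by
  have hcoords : ∀ v, (((coords : Plane →L[ℝ] ℝ × ℝ) ∘L sweepFDeriv w z : ℝ × ℝ →L[ℝ] ℝ × ℝ) :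
      ℝ × ℝ →ₗ[ℝ] ℝ × ℝ) v
        = (z.2 * (v.1 * deriv w z.1 0) + v.2 * w z.1 0,
          z.2 * (v.1 * deriv w z.1 1) + v.2 * w z.1 1) := fun _ => rfl
  rw [ContinuousLinearMap.det, ← LinearMap.det_toMatrix (.finTwoProd ℝ), Matrix.det_fin_two]
  simp only [LinearMap.toMatrix_apply, hcoords, Module.Basis.finTwoProd_zero,
    Module.Basis.finTwoProd_one, Module.Basis.coe_finTwoProd_repr, Matrix.cons_val_zero,
    Matrix.cons_val_one, cross_apply]
  ring

theorem isOpen_sweep_image (hw : ContDiff ℝ 1 w) {D : Set (ℝ × ℝ)} (hD : IsOpen D)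
    (hne : ∀ z ∈ D, z.2 * cross (w z.1) (deriv w z.1) ≠ 0) : IsOpen (sweep q w '' D) := by
  refine isOpen_iff_mem_nhds.2 ?_
  rintro _ ⟨z, hz, rfl⟩
  have hdet : ((coords : Plane →L[ℝ] ℝ × ℝ) ∘L sweepFDeriv w z).det ≠ 0 := by
    rw [det_coords_comp_sweepFDeriv]
    exact neg_ne_zero.2 (hne z hz)
  have hstrict := (contDiff_sweep (q := q) hw).contDiffAt.hasStrictFDerivAt'
    (hasFDerivAt_sweep (hw.differentiable one_ne_zero z.1)) one_ne_zero
  have hmap := HasStrictFDerivAt.map_nhds_eq_of_equiv (f' :=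
    (ContinuousLinearMap.toContinuousLinearEquivOfDetNeZero _ hdet).trans coords.symm)
    (hstrict.congr_fderiv (by ext v <;> simp))
  exact hmap ▸ Filter.image_mem_map (hD.mem_nhds hz)

theorem volume_sweep_image (hw : Differentiable ℝ w) {D : Set (ℝ × ℝ)} (hD : MeasurableSet D)
    (hinj : InjOn (sweep q w) D) :
    volume (sweep q w '' D)
      = ∫⁻ z in D, ENNReal.ofReal |z.2 * cross (w z.1) (deriv w z.1)| := by
  have hcov := lintegral_abs_det_fderiv_eq_addHaar_image volume hD
    (fun z _ => (coords.hasFDerivAt.comp z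
      (hasFDerivAt_sweep (q := q) (hw z.1))).hasFDerivWithinAt)
    (coords.injective.comp_injOn hinj)
  simp only [det_coords_comp_sweepFDeriv, abs_neg] at hcov
  rw [hcov, image_comp, volume_image_coords]

theorem volume_sweep_regionBetween (hw : ContDiff ℝ 1 w) {s : Set ℝ} {τ : ℝ → ℝ}
    (hs : MeasurableSet s) (hτ : Measurable τ) (hτ_nonneg : ∀ ψ ∈ s, 0 ≤ τ ψ)
    (hcross : ∀ ψ ∈ s, 0 ≤ cross (w ψ) (deriv w ψ))
    (hinj : InjOn (sweep q w) (regionBetween 0 τ s)) :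
    volume (sweep q w '' regionBetween 0 τ s)
      = ∫⁻ ψ in s, ENNReal.ofReal (τ ψ ^ 2 * cross (w ψ) (deriv w ψ) / 2) := by
  have hjacobian : Continuous fun z : ℝ × ℝ => z.2 * cross (w z.1) (deriv w z.1) := by
    have := hw.continuous
    have := hw.continuous_deriv le_rfl
    fun_prop
  rw [volume_sweep_image (hw.differentiable one_ne_zero)
    (measurableSet_regionBetween measurable_zero hτ hs) hinj, Measure.volume_eq_prod,
    lintegral_regionBetween measurable_zero hτ hs hjacobian.abs.measurable.ennreal_ofReal]
  refine setLIntegral_congr_fun hs fun ψ hψ => ?_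
  rw [← lintegral_Ioo_ofReal_mul (hτ_nonneg ψ hψ) (hcross ψ hψ)]
  refine setLIntegral_congr_fun measurableSet_Ioo fun t ht => ?_
  rw [abs_of_nonneg (mul_nonneg ht.1.le (hcross ψ hψ))]

end Sweep

/-! ### The interior of a star-shaped curve -/

theorem connectedComponentIn_compl_subset_of_isOpen {X : Type*} [TopologicalSpace X]
    {A U : Set X} {x : X} (hU : IsOpen U) (hUA : IsClosed (U ∪ A)) (hx : x ∈ U \ A) :
    connectedComponentIn Aᶜ x ⊆ U := by
  refine isPreconnected_connectedComponentIn.subset_left_of_subset_union hU hUA.isOpen_compl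
    (disjoint_compl_right.mono_left subset_union_left) (fun y hy => ?_)
    ⟨x, mem_connectedComponentIn hx.2, hx.1⟩
  by_cases hyU : y ∈ U
  · exact Or.inl hyU
  · exact Or.inr fun hyUA => hyUA.elim hyU (connectedComponentIn_subset _ _ hy)

section StarConvex

variable {E : Type*} [NormedAddCommGroup E] [NormedSpace ℝ E] {K : Set E} {q x : E}

theorem add_smul_sub_notMem_of_starConvex (hK : StarConvex ℝ q K) (hx : x ∉ K) {t : ℝ}
    (ht : 1 ≤ t) : q + t • (x - q) ∉ K := fun hmem => by
  have ht_pos : 0 < t := zero_lt_one.trans_le ht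
  have := hK.add_smul_sub_mem hmem (inv_nonneg.2 ht_pos.le) (inv_le_one_of_one_le₀ ht)
  rw [add_sub_cancel_left, inv_smul_smul₀ ht_pos.ne', add_sub_cancel] at this
  exact hx this

theorem not_isBounded_connectedComponentIn_compl_of_starConvex (hK : StarConvex ℝ q K)
    (hq : q ∈ K) (hx : x ∉ K) : ¬ Bornology.IsBounded (connectedComponentIn Kᶜ x) := by
  intro hbounded
  set ray := (fun t : ℝ => q + t • (x - q)) '' Ici 1
  have hray : ray ⊆ connectedComponentIn Kᶜ x := by
    refine (isPreconnected_Ici.image _ (by fun_prop)).subset_connectedComponentIn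
      ⟨1, self_mem_Ici, by simp⟩ ?_
    rintro _ ⟨t, ht, rfl⟩
    exact add_smul_sub_notMem_of_starConvex hK hx ht
  obtain ⟨C, hC⟩ := Metric.isBounded_iff.1 (hbounded.subset hray)
  have hnear : q + (1 : ℝ) • (x - q) ∈ ray := ⟨1, self_mem_Ici, rfl⟩
  have hC_nonneg : 0 ≤ C := dist_nonneg.trans (hC hnear hnear)
  have hne : 0 < ‖x - q‖ := norm_pos_iff.2 (sub_ne_zero.2 fun h => hx (h ▸ hq))
  have hfar := hC ⟨1 + (C + 1) / ‖x - q‖, mem_Ici.2 (le_add_of_nonneg_right (by positivity)),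
    rfl⟩ hnear
  rw [dist_add_left, dist_eq_norm, ← sub_smul, add_sub_cancel_left, norm_smul,
    Real.norm_of_nonneg (by positivity), div_mul_cancel₀ _ hne.ne'] at hfar
  linarith

end StarConvex

theorem inn_eq_of_starConvex {γ : ℝ → Plane} {U : Set Plane} {q : Plane} (hU : IsOpen U)
    (hdisj : Disjoint U (range γ)) (hcompact : IsCompact (U ∪ range γ))
    (hstar : StarConvex ℝ q (U ∪ range γ)) : inn γ = U := by
  have hq : q ∈ U ∪ range γ := hstar.mem ⟨γ 0, Or.inr (mem_range_self 0)⟩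
  ext x
  constructor
  · rintro ⟨hxγ, hbounded⟩
    by_contra hxU
    exact not_isBounded_connectedComponentIn_compl_of_starConvex hstar hq
      (fun hx => hx.elim hxU hxγ)
      (hbounded.subset (connectedComponentIn_mono x (compl_subset_compl.2 subset_union_right)))
  · intro hx
    have hxγ : x ∉ range γ := disjoint_left.1 hdisj hx
    exact ⟨hxγ, hcompact.isBounded.subset
      ((connectedComponentIn_compl_subset_of_isOpen hU hcompact.isClosed ⟨hx, hxγ⟩).trans
        subset_union_left)⟩

/-! ### The speed of an angle -/

theorem inner_mul_norm_sq_sub (u v w : Plane) :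
    ⟪u, w⟫ * ‖v‖ ^ 2 - ⟪u, v⟫ * ⟪v, w⟫ = -(cross u v * cross v w) := by
  rw [norm_sq_eq, inner_eq, inner_eq, inner_eq, cross_apply, cross_apply]
  ring

theorem sin_angle_of_cross_nonneg {u v : Plane} (h : 0 ≤ cross u v) :
    Real.sin (InnerProductGeometry.angle u v) * (‖u‖ * ‖v‖) = cross u v := by
  rw [InnerProductGeometry.sin_angle_mul_norm_mul_norm, real_inner_self_eq_norm_sq,
    real_inner_self_eq_norm_sq, ← cross_sq_add_inner_sq, ← sq, add_sub_cancel_right,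
    Real.sqrt_sq h]

theorem hasDerivAt_angle {u : Plane} {v : ℝ → Plane} {v' : Plane} {t : ℝ}
    (hv : HasDerivAt v v' t) (hcross : 0 < cross u (v t)) :
    HasDerivAt (fun t => InnerProductGeometry.angle u (v t)) (cross (v t) v' / ‖v t‖ ^ 2) t := by
  have hsin := sin_angle_of_cross_nonneg hcross.le
  have hnorms : 0 < ‖u‖ * ‖v t‖ := by
    refine lt_of_le_of_ne (by positivity) fun h0 => hcross.ne ?_
    rw [← hsin, ← h0, mul_zero]
  have hu : 0 < ‖u‖ := pos_of_mul_pos_left hnorms (norm_nonneg _)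
  have hvt : 0 < ‖v t‖ := pos_of_mul_pos_right hnorms (norm_nonneg _)
  have hsin_pos : 0 < Real.sin (InnerProductGeometry.angle u (v t)) :=
    pos_of_mul_pos_left (hsin ▸ hcross) hnorms.le
  have hnorm : HasDerivAt (fun t => ‖v t‖) (⟪v t, v'⟫ / ‖v t‖) t := by
    have := hv.norm_sq.sqrt (by positivity)
    simp only [Real.sqrt_sq (norm_nonneg _)] at this
    exact this.congr_deriv (by field_simp)
  have hcos := ((innerSL ℝ u).hasFDerivAt.comp_hasDerivAt t hv).div (hnorm.const_mul ‖u‖)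
    hnorms.ne'
  have hsqrt := Real.sin_arccos (⟪u, v t⟫ / (‖u‖ * ‖v t‖))
  change Real.sin (InnerProductGeometry.angle u (v t)) = _ at hsqrt
  have hne : ∀ x : ℝ, ⟪u, v t⟫ / (‖u‖ * ‖v t‖) = x → x ^ 2 ≠ 1 := fun x hx hx_sq => by
    rw [hsqrt, hx, hx_sq, sub_self, Real.sqrt_zero] at hsin_pos
    exact hsin_pos.false
  refine ((Real.hasDerivAt_arccos (fun hx => hne _ hx (by norm_num))
    (fun hx => hne _ hx (by norm_num))).comp t hcos).congr_deriv ?_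
  have hnumerator := inner_mul_norm_sq_sub u (v t) v'
  rw [← hsin] at hnumerator
  simp only [innerSL_apply_apply, Function.comp_apply]
  rw [← hsqrt]
  field_simp
  linear_combination -hnumerator

/-! ### The area formula -/

theorem starConvex_sweep_image (q : Plane) (w : ℝ → Plane) (s : Set ℝ) :
    StarConvex ℝ q (sweep q w '' (s ×ˢ Icc 0 1)) := by
  rintro _ ⟨⟨ψ, t⟩, ⟨hψ, ht⟩, rfl⟩ a b ha hb hab
  refine ⟨(ψ, b * t), ⟨hψ, mul_nonneg hb ht.1, mul_le_one₀ (by linarith) ht.1 ht.2⟩, ?_⟩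
  simp only [sweep, smul_add, smul_smul, ← add_assoc, ← add_smul, hab, one_smul]

/-- The sweep of the chords of `γ` issuing from `γ φ`: it takes `(ψ, t)` to the point at the
fraction `t` of the chord from `γ φ` to `γ ψ`. -/
abbrev chordSweep (γ : ℝ → Plane) (φ : ℝ) : ℝ × ℝ → Plane := sweep (γ φ) fun ψ => γ ψ - γ φ

theorem chordSweep_apply_one (γ : ℝ → Plane) (φ ψ : ℝ) : chordSweep γ φ (ψ, 1) = γ ψ := by
  simp only [sweep, one_smul, add_sub_cancel]

theorem chordSweep_eq_of_apply_eq {γ : ℝ → Plane} {φ ψ : ℝ} (hψ : γ ψ = γ φ) (t : ℝ) :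
    chordSweep γ φ (ψ, t) = γ φ := by
  simp only [sweep, hψ, sub_self, smul_zero, add_zero]

theorem chordSweep_image_union_range {γ : ℝ → Plane} (hγ : Function.Periodic γ (2 * π)) (φ : ℝ) :
    chordSweep γ φ '' (Ioo φ (φ + 2 * π) ×ˢ Ioo 0 1) ∪ range γ =
      chordSweep γ φ '' (Icc φ (φ + 2 * π) ×ˢ Icc 0 1) := by
  apply Subset.antisymm
  · refine union_subset (image_mono (prod_mono Ioo_subset_Icc_self Ioo_subset_Icc_self)) ?_
    rintro _ ⟨ψ, rfl⟩
    obtain ⟨χ, hχ, heq⟩ := hγ.exists_mem_Ico Real.two_pi_pos ψ φ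
    exact ⟨(χ, 1), ⟨Ico_subset_Icc_self hχ, right_mem_Icc.2 zero_le_one⟩,
      (chordSweep_apply_one γ φ χ).trans heq.symm⟩
  · rintro _ ⟨⟨ψ, t⟩, ⟨hψ, ht⟩, rfl⟩
    rcases hψ.1.eq_or_lt with rfl | hφψ
    · exact Or.inr ⟨φ, (chordSweep_eq_of_apply_eq rfl t).symm⟩
    rcases hψ.2.eq_or_lt with rfl | hψφ
    · exact Or.inr ⟨φ, (chordSweep_eq_of_apply_eq (hγ φ) t).symm⟩
    rcases ht.1.eq_or_lt with rfl | ht_pos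
    · exact Or.inr ⟨φ, by simp only [sweep, zero_smul, add_zero]⟩
    rcases ht.2.eq_or_lt with rfl | ht_lt
    · exact Or.inr ⟨ψ, (chordSweep_apply_one γ φ ψ).symm⟩
    · exact Or.inl ⟨(ψ, t), ⟨⟨hφψ, hψφ⟩, ht_pos, ht_lt⟩, rfl⟩

/-- The density in the parameter `ψ` of the area of the part of `B_r(γ φ)` that is swept by the
chords from `γ φ` to `γ ψ`: each chord contributes only up to its length `r`. At `γ ψ = γ φ`, where
`r / ‖γ ψ - γ φ‖` is a junk value, the second factor vanishes. -/
def sectorDensity (r : ℝ) (γ : ℝ → Plane) (φ ψ : ℝ) : ℝ :=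
  min 1 (r / ‖γ ψ - γ φ‖) ^ 2 * cross (γ ψ - γ φ) (deriv γ ψ) / 2

theorem sectorDensity_of_dist_le {r : ℝ} {γ : ℝ → Plane} {φ ψ : ℝ} (hψ : dist (γ ψ) (γ φ) ≤ r) :
    sectorDensity r γ φ ψ = 1 / 2 * cross (γ ψ - γ φ) (deriv γ ψ) := by
  rw [dist_eq_norm] at hψ
  rcases eq_or_ne (γ ψ - γ φ) 0 with hchord | hchord
  · simp only [sectorDensity, hchord, map_zero, zero_apply, mul_zero, zero_div]
  · rw [sectorDensity, min_eq_left ((one_le_div (norm_pos_iff.2 hchord)).2 hψ)]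
    ring

theorem sectorDensity_of_le_dist {r : ℝ} {γ : ℝ → Plane} {φ ψ : ℝ} (hr : 0 < r)
    (hψ : r ≤ dist (γ ψ) (γ φ)) : sectorDensity r γ φ ψ =
      r ^ 2 / 2 * (cross (γ ψ - γ φ) (deriv γ ψ) / ‖γ ψ - γ φ‖ ^ 2) := by
  rw [dist_eq_norm] at hψ
  rw [sectorDensity, min_eq_right ((div_le_one (hr.trans_le hψ)).2 hψ)]
  ring

theorem sectorDensity_periodic (r : ℝ) {γ : ℝ → Plane} (hγ : Function.Periodic γ (2 * π)) (φ : ℝ) :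
    Function.Periodic (sectorDensity r γ φ) (2 * π) := fun ψ => by
  have hderiv : deriv γ (ψ + 2 * π) = deriv γ ψ := by
    rw [← deriv_comp_add_const, funext hγ]
  rw [sectorDensity, hγ, hderiv, sectorDensity]

namespace NearCircle

variable {r x₁ : ℝ} {γ : ℝ → Plane} (h : NearCircle r x₁ γ)

include h

theorem contDiff_chord (φ : ℝ) : ContDiff ℝ 1 fun ψ => γ ψ - γ φ :=
  h.contDiff.sub contDiff_const

theorem cross_chord_deriv_pos {φ ψ : ℝ} (hψ : ψ ∈ Ioo φ (φ + 2 * π)) :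
    0 < cross (γ ψ - γ φ) (deriv γ ψ) := by
  rw [cross_swap, ← map_neg, neg_sub]
  exact h.cross_deriv_right_pos hψ.1 hψ.2

theorem chord_ne_zero {φ ψ : ℝ} (hψ : ψ ∈ Ioo φ (φ + 2 * π)) : γ ψ - γ φ ≠ 0 := fun hchord => by
  have := h.cross_chord_deriv_pos hψ
  rw [hchord, map_zero] at this
  exact this.false

theorem continuous_cross_chord_deriv (φ : ℝ) :
    Continuous fun ψ => cross (γ ψ - γ φ) (deriv γ ψ) :=
  (cross.continuous.comp (h.contDiff_chord φ).continuous).clm_apply h.continuous_deriv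

theorem injOn_chordSweep (φ : ℝ) : InjOn (chordSweep γ φ) (Ioo φ (φ + 2 * π) ×ˢ Ioi 0) := by
  have hnot_lt : ∀ {a b s t : ℝ}, a ∈ Ioo φ (φ + 2 * π) → b ∈ Ioo φ (φ + 2 * π) → 0 < s → 0 < t →
      s • (γ a - γ φ) = t • (γ b - γ φ) → ¬ a < b := fun {a b s t} ha hb hs ht heq hlt => by
    have hpos := mul_pos hs (mul_pos ht (h.cross_chords_pos ha.1 hlt hb.2))
    have hzero := cross_self (s • (γ a - γ φ))
    nth_rw 2 [heq] at hzero
    rw [map_smul, map_smul, smul_apply, smul_eq_mul, smul_eq_mul, mul_left_comm] at hzero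
    exact hpos.ne' hzero
  rintro ⟨a, s⟩ ⟨ha, hs⟩ ⟨b, t⟩ ⟨hb, ht⟩ hab
  have heq : s • (γ a - γ φ) = t • (γ b - γ φ) := add_left_cancel hab
  obtain rfl : a = b :=
    le_antisymm (not_lt.1 (hnot_lt hb ha ht hs heq.symm)) (not_lt.1 (hnot_lt ha hb hs ht heq))
  rw [smul_left_injective ℝ (h.chord_ne_zero ha) heq]

theorem disjoint_chordSweep_image_range (φ : ℝ) :
    Disjoint (chordSweep γ φ '' (Ioo φ (φ + 2 * π) ×ˢ Ioo 0 1)) (range γ) := by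
  rw [disjoint_left]
  rintro _ ⟨⟨ψ, t⟩, ⟨hψ, ht⟩, rfl⟩ ⟨χ', heq⟩
  obtain ⟨χ, hχ, hχ'⟩ := h.periodic.exists_mem_Ico Real.two_pi_pos χ' φ
  rw [hχ'] at heq
  rcases hχ.1.eq_or_lt with rfl | hφχ
  · exact smul_ne_zero ht.1.ne' (h.chord_ne_zero hψ) (left_eq_add.1 heq)
  · rw [← chordSweep_apply_one γ φ χ] at heq
    have := h.injOn_chordSweep φ ⟨⟨hφχ, hχ.2⟩, mem_Ioi.2 one_pos⟩ ⟨hψ, ht.1⟩ heq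
    exact ht.2.ne (congrArg Prod.snd this).symm

theorem inn_eq (φ : ℝ) : inn γ = chordSweep γ φ '' (Ioo φ (φ + 2 * π) ×ˢ Ioo 0 1) := by
  have hunion := chordSweep_image_union_range h.periodic φ
  refine inn_eq_of_starConvex (q := γ φ) ?_ (h.disjoint_chordSweep_image_range φ) ?_ ?_
  · refine isOpen_sweep_image (h.contDiff_chord φ) (isOpen_Ioo.prod isOpen_Ioo) fun z hz => ?_
    rw [deriv_sub_const]
    exact (mul_pos hz.2.1 (h.cross_chord_deriv_pos hz.1)).ne'
  · rw [hunion]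
    exact (isCompact_Icc.prod isCompact_Icc).image (contDiff_sweep (h.contDiff_chord φ)).continuous
  · rw [hunion]
    exact starConvex_sweep_image _ _ _

theorem ball_inter_inn_eq (φ : ℝ) : Metric.ball (γ φ) r ∩ inn γ = chordSweep γ φ ''
    regionBetween 0 (fun ψ => min 1 (r / ‖γ ψ - γ φ‖)) (Ioo φ (φ + 2 * π)) := by
  have hball : ∀ ψ ∈ Ioo φ (φ + 2 * π), ∀ t, 0 < t →
      (chordSweep γ φ (ψ, t) ∈ Metric.ball (γ φ) r ↔ t < r / ‖γ ψ - γ φ‖) := fun ψ hψ t ht => by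
    rw [mem_ball_iff_norm, chordSweep, sweep, add_sub_cancel_left, norm_smul,
      Real.norm_of_nonneg ht.le, lt_div_iff₀ (norm_pos_iff.2 (h.chord_ne_zero hψ))]
  rw [h.inn_eq φ]
  ext x
  constructor
  · rintro ⟨hx, ⟨ψ, t⟩, ⟨hψ, ht⟩, rfl⟩
    exact ⟨(ψ, t), ⟨hψ, ht.1, lt_min ht.2 ((hball ψ hψ t ht.1).1 hx)⟩, rfl⟩
  · rintro ⟨⟨ψ, t⟩, ⟨hψ, ht⟩, rfl⟩
    exact ⟨(hball ψ hψ t ht.1).2 (ht.2.trans_le (min_le_right _ _)), (ψ, t),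
      ⟨hψ, ht.1, ht.2.trans_le (min_le_left _ _)⟩, rfl⟩

theorem invariant_eq_integral (φ : ℝ) :
    invariant r γ φ = ∫ ψ in φ..(φ + 2 * π), sectorDensity r γ φ ψ := by
  have hmeas : Measurable fun ψ => min 1 (r / ‖γ ψ - γ φ‖) :=
    measurable_const.min (measurable_const.div (h.contDiff_chord φ).continuous.norm.measurable)
  have hcross : ∀ ψ ∈ Ioo φ (φ + 2 * π), 0 ≤ cross (γ ψ - γ φ) (deriv γ ψ) :=
    fun ψ hψ => (h.cross_chord_deriv_pos hψ).le
  have hinj : InjOn (chordSweep γ φ)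
      (regionBetween 0 (fun ψ => min 1 (r / ‖γ ψ - γ φ‖)) (Ioo φ (φ + 2 * π))) :=
    (h.injOn_chordSweep φ).mono fun z hz => mk_mem_prod hz.1 hz.2.1
  have hvolume := volume_sweep_regionBetween (q := γ φ) (h.contDiff_chord φ) measurableSet_Ioo
    hmeas (fun ψ _ => le_min zero_le_one (div_nonneg h.r_pos.le (norm_nonneg _)))
    (fun ψ hψ => by rw [deriv_sub_const]; exact hcross ψ hψ) hinj
  simp only [deriv_sub_const] at hvolume
  rw [invariant, h.ball_inter_inn_eq, hvolume, intervalIntegral.integral_of_le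
    (by linarith [Real.pi_pos]), integral_Ioc_eq_integral_Ioo, integral_eq_lintegral_of_nonneg_ae]
  · rfl
  · filter_upwards [ae_restrict_mem measurableSet_Ioo] with ψ hψ
    exact div_nonneg (mul_nonneg (sq_nonneg _) (hcross ψ hψ)) two_pos.le
  · exact (((hmeas.pow_const 2).mul (h.continuous_cross_chord_deriv φ).measurable).div_const
      2).aestronglyMeasurable

theorem continuousOn_angle_speed (φ : ℝ) :
    ContinuousOn (fun ψ => cross (γ ψ - γ φ) (deriv γ ψ) / ‖γ ψ - γ φ‖ ^ 2)
      (Icc (nextParam r γ φ) (prevParam r γ φ + 2 * π)) := by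
  refine (h.continuous_cross_chord_deriv φ).continuousOn.div
    ((h.contDiff_chord φ).continuous.norm.pow 2).continuousOn fun ψ hψ => ?_
  rw [← dist_eq_norm]
  exact pow_ne_zero 2 (h.r_pos.trans_le (h.le_dist_of_mem_Icc hψ)).ne'

theorem integral_angle_speed (φ : ℝ) :
    ∫ ψ in (nextParam r γ φ)..(prevParam r γ φ + 2 * π),
        cross (γ ψ - γ φ) (deriv γ ψ) / ‖γ ψ - γ φ‖ ^ 2 =
      Real.arccos (⟪γ (nextParam r γ φ) - γ φ, γ (prevParam r γ φ) - γ φ⟫ / r ^ 2) := by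
  have hp := h.nextParam_mem_Ioo φ
  have hm := h.prevParam_mem_Ioo φ
  have hlt := h.nextParam_lt φ
  have hp_norm := (dist_eq_norm (γ (nextParam r γ φ)) (γ φ)).symm.trans (h.dist_nextParam φ)
  have hm_norm := (dist_eq_norm (γ (prevParam r γ φ)) (γ φ)).symm.trans (h.dist_prevParam φ)
  have hne : ∀ ψ ∈ Icc (nextParam r γ φ) (prevParam r γ φ + 2 * π), γ ψ - γ φ ≠ 0 :=
    fun ψ hψ => h.chord_ne_zero ⟨hp.1.trans_le hψ.1, by linarith [hψ.2, hm.2]⟩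
  rw [intervalIntegral.integral_eq_sub_of_hasDerivAt_of_le (f := fun ψ =>
    InnerProductGeometry.angle (γ (nextParam r γ φ) - γ φ) (γ ψ - γ φ)) hlt.le]
  · rw [InnerProductGeometry.angle_self (hne _ ⟨le_rfl, hlt.le⟩), sub_zero, h.periodic,
      InnerProductGeometry.angle, hp_norm, hm_norm, ← sq]
  · intro ψ hψ
    exact ((InnerProductGeometry.continuousAt_angle (x := (_, γ ψ - γ φ))
      (hne _ ⟨le_rfl, hlt.le⟩) (hne ψ hψ)).comp (f := fun ψ => (_, γ ψ - γ φ))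
      (continuousAt_const.prodMk (h.contDiff_chord φ).continuous.continuousAt)).continuousWithinAt
  · intro ψ hψ
    exact hasDerivAt_angle ((h.hasDerivAt ψ).sub_const (γ φ))
      (h.cross_chords_pos hp.1 hψ.1 (by linarith [hψ.2, hm.2]))
  · refine ContinuousOn.intervalIntegrable ?_
    rw [uIcc_of_le hlt.le]
    exact h.continuousOn_angle_speed φ

theorem invariant_eq_invariantFormula (φ : ℝ) : invariant r γ φ = invariantFormula r γ φ := by
  set p := nextParam r γ φ with hp
  set m := prevParam r γ φ with hm
  have hmp : m ≤ p := (h.prevParam_mem_Ioo φ).2.le.trans (h.nextParam_mem_Ioo φ).1.le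
  have hpm : p ≤ m + 2 * π := (h.nextParam_lt φ).le
  have hnear : EqOn (sectorDensity r γ φ)
      (fun ψ => 1 / 2 * cross (γ ψ - γ φ) (deriv γ ψ)) (uIcc m p) := fun ψ hψ =>
    sectorDensity_of_dist_le (h.dist_le_of_mem_Icc (by rwa [uIcc_of_le hmp] at hψ))
  have hfar : EqOn (sectorDensity r γ φ)
      (fun ψ => r ^ 2 / 2 * (cross (γ ψ - γ φ) (deriv γ ψ) / ‖γ ψ - γ φ‖ ^ 2))
      (uIcc p (m + 2 * π)) := fun ψ hψ =>
    sectorDensity_of_le_dist h.r_pos (h.le_dist_of_mem_Icc (by rwa [uIcc_of_le hpm] at hψ))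
  have hnear_int : IntervalIntegrable (sectorDensity r γ φ) volume m p :=
    (((h.continuous_cross_chord_deriv φ).const_mul _).continuousOn.congr hnear).intervalIntegrable
  have hfar_int : IntervalIntegrable (sectorDensity r γ φ) volume p (m + 2 * π) := by
    refine (ContinuousOn.congr ?_ hfar).intervalIntegrable
    rw [uIcc_of_le hpm]
    exact (h.continuousOn_angle_speed φ).const_mul _
  rw [h.invariant_eq_integral,
    (sectorDensity_periodic r h.periodic φ).intervalIntegral_add_eq φ m,
    ← intervalIntegral.integral_add_adjacent_intervals hnear_int hfar_int,
    intervalIntegral.integral_congr hnear, intervalIntegral.integral_congr hfar,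
    intervalIntegral.integral_const_mul, intervalIntegral.integral_const_mul,
    h.integral_angle_speed, invariantFormula]
  simp only [inner_perp, ← hp, ← hm]

end NearCircle

/-! ### Smooth dependence on the curve and the parameter -/

theorem contDiffAt_of_eventually_unique {Y : Type*} [NormedAddCommGroup Y] [NormedSpace ℝ Y]
    [CompleteSpace Y] {n : WithTop ℕ∞} (hn : n ≠ 0) {G : Y × ℝ → ℝ} {y₀ : Y} {p : Y → ℝ}
    (hG : ContDiffAt ℝ n G (y₀, p y₀)) {d : ℝ} (hd : HasDerivAt (fun x => G (y₀, x)) d (p y₀))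
    (hd0 : d ≠ 0) (huniq : ∀ᶠ z in 𝓝 (y₀, p y₀), G z = G (y₀, p y₀) → z.2 = p z.1) :
    ContDiffAt ℝ n p y₀ := by
  have hpartial : fderiv ℝ G (y₀, p y₀) (0, 1) = d :=
    ((hG.differentiableAt hn).hasFDerivAt.comp_hasDerivAt (p y₀)
      ((hasDerivAt_const (p y₀) y₀).prodMk (hasDerivAt_id (p y₀)))).unique hd
  have hinv : (fderiv ℝ G (y₀, p y₀) ∘L .inr ℝ Y ℝ).IsInvertible := by
    refine ⟨ContinuousLinearEquiv.unitsEquivAut ℝ (Units.mk0 d hd0), ?_⟩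
    ext
    simp [hpartial]
  have hsmooth := hG.contDiffAt_implicitFunction hn hinv
  have hgraph : Filter.Tendsto (fun y => (y, hG.implicitFunction hn hinv y)) (𝓝 y₀)
      (𝓝 (y₀, p y₀)) := by
    have hlim := hsmooth.continuousAt.tendsto
    rw [hG.implicitFunction_apply_self hn hinv] at hlim
    exact Filter.tendsto_id.prodMk_nhds hlim
  refine hsmooth.congr_of_eventuallyEq ?_
  filter_upwards [hgraph.eventually huniq, hG.eventually_apply_implicitFunction hn hinv]
    with y hunique hsol
  exact (hunique hsol).symm

theorem contDiff_integral {W : Type*} [NormedAddCommGroup W] [NormedSpace ℝ W] [CompleteSpace W]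
    {b : ℝ → W} {m : ℕ} (hb : ContDiff ℝ m b) (a : ℝ) :
    ContDiff ℝ (m + 1 : ℕ) fun s => ∫ x in a..s, b x := by
  have hderiv := fun s => (hb.continuous.integral_hasStrictDerivAt a s).hasDerivAt
  push_cast
  refine contDiff_succ_iff_deriv.2 ⟨fun s => (hderiv s).differentiableAt, by simp, ?_⟩
  rwa [show deriv (fun s => ∫ x in a..s, b x) = b from funext fun s => (hderiv s).deriv]

theorem integral_bilin_deriv_right {E F G : Type*} [NormedAddCommGroup E] [NormedSpace ℝ E]
    [NormedAddCommGroup F] [NormedSpace ℝ F] [NormedAddCommGroup G] [NormedSpace ℝ G]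
    [CompleteSpace G] (B : E →L[ℝ] F →L[ℝ] G) {f : ℝ → E} {g : ℝ → F} (hf : ContDiff ℝ 1 f)
    (hg : ContDiff ℝ 1 g) (a b : ℝ) :
    ∫ x in a..b, B (f x) (deriv g x) =
      B (f b) (g b) - B (f a) (g a) - ∫ x in a..b, B (deriv f x) (g x) := by
  have hderiv := fun x => B.hasDerivAt_of_bilinear
    (fun _ => (hf.differentiable one_ne_zero x).hasDerivAt)
    (fun _ => (hg.differentiable one_ne_zero x).hasDerivAt)
  have hint₁ : IntervalIntegrable (fun x => B (f x) (deriv g x)) volume a b :=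
    ((B.continuous.comp hf.continuous).clm_apply
      (hg.continuous_deriv le_rfl)).intervalIntegrable a b
  have hint₂ : IntervalIntegrable (fun x => B (deriv f x) (g x)) volume a b :=
    ((B.continuous.comp (hf.continuous_deriv le_rfl)).clm_apply
      hg.continuous).intervalIntegrable a b
  rw [eq_sub_iff_add_eq, ← intervalIntegral.integral_add hint₁ hint₂]
  exact intervalIntegral.integral_eq_sub_of_hasDerivAt (fun x _ => hderiv x) (hint₁.add hint₂)

theorem contDiff_bilinearComp {X E E' F F' G : Type*} [NormedAddCommGroup X] [NormedSpace ℝ X]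
    [NormedAddCommGroup E] [NormedSpace ℝ E] [NormedAddCommGroup E'] [NormedSpace ℝ E']
    [NormedAddCommGroup F] [NormedSpace ℝ F] [NormedAddCommGroup F'] [NormedSpace ℝ F']
    [NormedAddCommGroup G] [NormedSpace ℝ G] (B : E →L[ℝ] F →L[ℝ] G) {m : WithTop ℕ∞}
    {u : X → E' →L[ℝ] E} {v : X → F' →L[ℝ] F} (hu : ContDiff ℝ m u) (hv : ContDiff ℝ m v) :
    ContDiff ℝ m fun x => B.bilinearComp (u x) (v x) := by
  have hcomp : (fun x => B.bilinearComp (u x) (v x)) =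
      fun x => (ContinuousLinearMap.compL ℝ F' F G).flip (v x) ∘L (B ∘L u x) := rfl
  rw [hcomp]
  exact ((ContinuousLinearMap.compL ℝ F' F G).flip.contDiff.comp hv).clm_comp
    (contDiff_const.clm_comp hu)

theorem NearCircle.eq_nextParam {r x₁ : ℝ} {γ : ℝ → Plane} (h : NearCircle r x₁ γ) {φ ψ : ℝ}
    (hψ : ψ ∈ Ioo φ (φ + x₁)) (hr : dist (γ ψ) (γ φ) = r) : ψ = nextParam r γ φ :=
  (h.strictMonoOn_dist φ).injOn (Ioo_subset_Icc_self hψ)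
    (Ioo_subset_Icc_self (h.nextParam_mem_Ioo φ)) (hr.trans (h.dist_nextParam φ).symm)

theorem NearCircle.eq_prevParam {r x₁ : ℝ} {γ : ℝ → Plane} (h : NearCircle r x₁ γ) {φ ψ : ℝ}
    (hψ : ψ ∈ Ioo (φ - x₁) φ) (hr : dist (γ ψ) (γ φ) = r) : ψ = prevParam r γ φ :=
  (h.strictAntiOn_dist φ).injOn (Ioo_subset_Icc_self hψ)
    (Ioo_subset_Icc_self (h.prevParam_mem_Ioo φ)) (hr.trans (h.dist_prevParam φ).symm)

section Smoothness

variable {n m : ℕ} {r x₁ : ℝ} {γ : CkCircle n Plane}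

theorem contDiff_dist_sq (hm : m + 1 ≤ n) :
    ContDiff ℝ m (fun z : (CkCircle n Plane × ℝ) × ℝ => dist (z.1.1 z.2) (z.1.1 z.1.2) ^ 2) := by
  have heval := CkCircle.contDiff_eval (E := Plane) hm
  simp only [dist_eq_norm]
  exact ((heval.comp (contDiff_fst.fst.prodMk contDiff_snd)).sub
    (heval.comp contDiff_fst)).norm_sq ℝ

theorem contDiffAt_of_dist_eq (hm : m + 1 ≤ n) (hm0 : m ≠ 0) {φ : ℝ} {q : CkCircle n Plane × ℝ → ℝ}
    (hr : 0 ≤ r) (hdist : dist (γ (q (γ, φ))) (γ φ) = r)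
    (htrans : ⟪deriv γ (q (γ, φ)), γ (q (γ, φ)) - γ φ⟫ ≠ 0)
    (huniq : ∀ᶠ z : (CkCircle n Plane × ℝ) × ℝ in 𝓝 ((γ, φ), q (γ, φ)),
      dist (z.1.1 z.2) (z.1.1 z.1.2) = r → z.2 = q z.1) :
    ContDiffAt ℝ m q (γ, φ) := by
  refine contDiffAt_of_eventually_unique (by exact_mod_cast hm0) (contDiff_dist_sq hm).contDiffAt
    (hasDerivAt_dist_sq (γ.hasDerivAt (by omega) _) (γ φ)) (mul_ne_zero two_ne_zero htrans) ?_
  filter_upwards [huniq] with z hz hsq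
  simp only [hdist] at hsq
  exact hz ((pow_left_inj₀ dist_nonneg hr two_ne_zero).1 hsq)

theorem contDiffAt_nextParam (hm : m + 1 ≤ n) (hm0 : m ≠ 0)
    (hnear : ∀ᶠ γ' : CkCircle n Plane in 𝓝 γ, NearCircle r x₁ γ') (φ : ℝ) :
    ContDiffAt ℝ m (fun z : CkCircle n Plane × ℝ => nextParam r z.1 z.2) (γ, φ) := by
  have h := hnear.self_of_nhds
  have hp := h.nextParam_mem_Ioo φ
  refine contDiffAt_of_dist_eq hm hm0 h.r_pos.le (h.dist_nextParam φ) (h.inner_nextParam_pos φ).ne'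
    ?_
  filter_upwards [(continuous_fst.fst.tendsto _).eventually hnear,
    (isOpen_lt continuous_fst.snd continuous_snd).mem_nhds hp.1,
    (isOpen_lt continuous_snd (continuous_fst.snd.add_const x₁)).mem_nhds hp.2]
    with z hz hlt hlt' hdist
  exact hz.eq_nextParam ⟨hlt, hlt'⟩ hdist

theorem contDiffAt_prevParam (hm : m + 1 ≤ n) (hm0 : m ≠ 0)
    (hnear : ∀ᶠ γ' : CkCircle n Plane in 𝓝 γ, NearCircle r x₁ γ') (φ : ℝ) :
    ContDiffAt ℝ m (fun z : CkCircle n Plane × ℝ => prevParam r z.1 z.2) (γ, φ) := by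
  have h := hnear.self_of_nhds
  have hq := h.prevParam_mem_Ioo φ
  refine contDiffAt_of_dist_eq hm hm0 h.r_pos.le (h.dist_prevParam φ) (h.inner_prevParam_neg φ).ne
    ?_
  filter_upwards [(continuous_fst.fst.tendsto _).eventually hnear,
    (isOpen_lt (continuous_fst.snd.sub continuous_const) continuous_snd).mem_nhds hq.1,
    (isOpen_lt continuous_snd continuous_fst.snd).mem_nhds hq.2]
    with z hz hlt hlt' hdist
  exact hz.eq_prevParam ⟨hlt, hlt'⟩ hdist

/-- The bilinear form `(f, g) ↦ cross (f s) (g' s)`, the integrand of the area form. -/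
def areaDensity (hn : 1 ≤ n) (s : ℝ) : CkCircle n Plane →L[ℝ] CkCircle n Plane →L[ℝ] ℝ :=
  cross.bilinearComp (CkCircle.evJet (Nat.zero_le n) s) (CkCircle.evJet hn s)

theorem areaDensity_apply (hn : 1 ≤ n) (s : ℝ) (f g : CkCircle n Plane) :
    areaDensity hn s f g = cross (f s) (deriv g s) := by
  rw [areaDensity, ContinuousLinearMap.bilinearComp_apply, CkCircle.evJet_zero_apply,
    CkCircle.evJet_one_apply]

theorem contDiff_areaDensity (hn : 1 ≤ n) (hm : m + 2 ≤ n) : ContDiff ℝ m (areaDensity hn) := by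
  exact contDiff_bilinearComp cross (CkCircle.contDiff_evJet (by omega))
    (CkCircle.contDiff_evJet (by omega))

/-- The bilinear form `(f, g) ↦ ∫₀ˢ cross f g'`. Its diagonal is twice the signed area swept by the
ray from the origin to the curve. -/
def areaForm (hn : 1 ≤ n) (s : ℝ) : CkCircle n Plane →L[ℝ] CkCircle n Plane →L[ℝ] ℝ :=
  ∫ ψ in (0 : ℝ)..s, areaDensity hn ψ

theorem contDiff_areaForm (hn : 1 ≤ n) (hm : m + 1 ≤ n) (hm0 : m ≠ 0) :
    ContDiff ℝ m (areaForm hn) := by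
  obtain ⟨m, rfl⟩ := Nat.exists_eq_add_one_of_ne_zero hm0
  exact contDiff_integral (contDiff_areaDensity hn (by omega)) 0

theorem continuous_areaDensity (hn : 2 ≤ n) : Continuous (areaDensity (one_le_two.trans hn)) :=
  (contDiff_areaDensity (m := 0) _ (by omega)).continuous

theorem hasDerivAt_areaForm (hn : 2 ≤ n) (s : ℝ) :
    HasDerivAt (areaForm (one_le_two.trans hn)) (areaDensity (one_le_two.trans hn) s) s :=
  ((continuous_areaDensity hn).integral_hasStrictDerivAt 0 s).hasDerivAt

theorem integral_cross_deriv_eq_areaForm (hn : 2 ≤ n) (a b : ℝ) (f g : CkCircle n Plane) :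
    ∫ ψ in a..b, cross (f ψ) (deriv g ψ) =
      areaForm (one_le_two.trans hn) b f g - areaForm (one_le_two.trans hn) a f g := by
  have hderiv : ∀ s, HasDerivAt (fun s => areaForm (one_le_two.trans hn) s f g)
      (cross (f s) (deriv g s)) s := fun s => by
    simpa only [areaDensity_apply, map_zero, add_zero] using
      ((hasDerivAt_areaForm hn s).clm_apply (hasDerivAt_const s f)).clm_apply (hasDerivAt_const s g)
  exact intervalIntegral.integral_eq_sub_of_hasDerivAt (fun s _ => hderiv s)
    (((cross.continuous.comp f.continuous).clm_apply
      (g.continuous_deriv (one_le_two.trans hn))).intervalIntegrable a b)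

theorem integral_cross_sub_const_deriv (hn : 2 ≤ n) (a b : ℝ) (v : Plane) :
    ∫ ψ in a..b, cross (γ ψ - v) (deriv γ ψ) =
      areaForm (one_le_two.trans hn) b γ γ - areaForm (one_le_two.trans hn) a γ γ
        - cross v (γ b - γ a) := by
  have hn1 : 1 ≤ n := one_le_two.trans hn
  have hconst : ∫ ψ in a..b, cross v (deriv γ ψ) = cross v (γ b - γ a) := by
    rw [(cross v).intervalIntegral_comp_comm ((γ.continuous_deriv hn1).intervalIntegrable a b),
      intervalIntegral.integral_eq_sub_of_hasDerivAt (fun ψ _ => γ.hasDerivAt hn1 ψ)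
        ((γ.continuous_deriv hn1).intervalIntegrable a b)]
  have hint₁ : IntervalIntegrable (fun ψ => cross (γ ψ) (deriv γ ψ)) volume a b :=
    ((cross.continuous.comp γ.continuous).clm_apply (γ.continuous_deriv hn1)).intervalIntegrable a b
  have hint₂ : IntervalIntegrable (fun ψ => cross v (deriv γ ψ)) volume a b :=
    ((cross v).continuous.comp (γ.continuous_deriv hn1)).intervalIntegrable a b
  simp only [map_sub cross, sub_apply]
  rw [intervalIntegral.integral_sub hint₁ hint₂, integral_cross_deriv_eq_areaForm hn, hconst]

theorem invariantFormula_eq_areaForm (hn : 2 ≤ n) (r : ℝ) (γ : CkCircle n Plane) (φ : ℝ) :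
    invariantFormula r γ φ =
      1 / 2 * (areaForm (one_le_two.trans hn) (nextParam r γ φ) γ γ
        - areaForm (one_le_two.trans hn) (prevParam r γ φ) γ γ
        - cross (γ φ) (γ (nextParam r γ φ) - γ (prevParam r γ φ)))
      + r ^ 2 / 2 * Real.arccos
        (⟪γ (nextParam r γ φ) - γ φ, γ (prevParam r γ φ) - γ φ⟫ / r ^ 2) := by
  simp only [invariantFormula, inner_perp, integral_cross_sub_const_deriv hn]

theorem NearCircle.abs_inner_next_prev_lt {γ : ℝ → Plane} (h : NearCircle r x₁ γ) (φ : ℝ) :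
    |⟪γ (nextParam r γ φ) - γ φ, γ (prevParam r γ φ) - γ φ⟫| < r ^ 2 := by
  refine abs_lt_of_sq_lt_sq ?_ (sq_nonneg r)
  rw [← pow_mul]
  exact sub_pos.1 (h.nonDegenerate φ).2.2

theorem contDiffAt_arccos_div {E : Type*} [NormedAddCommGroup E] [NormedSpace ℝ E]
    {f : E → ℝ} {x : E} {a : ℝ} {m : WithTop ℕ∞} (hf : ContDiffAt ℝ m f x) (hlt : |f x| < a) :
    ContDiffAt ℝ m (fun y => Real.arccos (f y / a)) x := by
  have ha : 0 < a := (abs_nonneg _).trans_lt hlt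
  have habs : |f x / a| < 1 := by rwa [abs_div, abs_of_pos ha, div_lt_one ha]
  exact ContDiffAt.comp (g := Real.arccos) x
    (Real.contDiffAt_arccos (abs_lt.1 habs).1.ne' (abs_lt.1 habs).2.ne) (hf.div_const a)

theorem contDiffAt_invariantFormula (hm : m + 1 ≤ n) (hm0 : m ≠ 0)
    (hnear : ∀ᶠ γ' : CkCircle n Plane in 𝓝 γ, NearCircle r x₁ γ') (φ : ℝ) :
    ContDiffAt ℝ m (fun z : CkCircle n Plane × ℝ => invariantFormula r z.1 z.2) (γ, φ) := by
  have hn : 2 ≤ n := by omega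
  have hnext := contDiffAt_nextParam hm hm0 hnear φ
  have hprev := contDiffAt_prevParam hm hm0 hnear φ
  have hcurve : ContDiffAt ℝ m (fun z : CkCircle n Plane × ℝ => z.1) (γ, φ) := contDiffAt_fst
  have heval := (CkCircle.contDiff_eval (E := Plane) hm).contDiffAt (x := (γ, φ))
  have heval_next := (CkCircle.contDiff_eval (E := Plane) hm).contDiffAt.comp (γ, φ)
    (hcurve.prodMk hnext)
  have heval_prev := (CkCircle.contDiff_eval (E := Plane) hm).contDiffAt.comp (γ, φ)
    (hcurve.prodMk hprev)
  have hform := contDiff_areaForm (one_le_two.trans hn) hm hm0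
  have harea_next := ((hform.contDiffAt.comp (γ, φ) hnext).clm_apply hcurve).clm_apply hcurve
  have harea_prev := ((hform.contDiffAt.comp (γ, φ) hprev).clm_apply hcurve).clm_apply hcurve
  have hchord := (cross.contDiff.contDiffAt.comp (γ, φ) heval).clm_apply
    (heval_next.sub heval_prev)
  have hangle := contDiffAt_arccos_div ((heval_next.sub heval).inner ℝ (heval_prev.sub heval))
    (hnear.self_of_nhds.abs_inner_next_prev_lt φ)
  refine (((contDiffAt_const (c := (1 / 2 : ℝ))).mul ((harea_next.sub harea_prev).sub hchord)).add
    ((contDiffAt_const (c := r ^ 2 / 2)).mul hangle)).congr_of_eventuallyEq (.of_forall fun z => ?_)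
  exact invariantFormula_eq_areaForm hn r z.1 z.2

end Smoothness

/-! ### The derivative in a direction -/

theorem hasDerivAt_arccos_div {f : ℝ → ℝ} {f' t a : ℝ} (hf : HasDerivAt f f' t)
    (hlt : |f t| < a) :
    HasDerivAt (fun t => Real.arccos (f t / a)) (-f' / √(a ^ 2 - f t ^ 2)) t := by
  have ha : 0 < a := (abs_nonneg _).trans_lt hlt
  have hsqrt : √(1 - (f t / a) ^ 2) = √(a ^ 2 - f t ^ 2) / a := by
    rw [div_pow, one_sub_div (by positivity), Real.sqrt_div' _ (sq_nonneg a), Real.sqrt_sq ha.le]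
  have habs : |f t / a| < 1 := by rwa [abs_div, abs_of_pos ha, div_lt_one ha]
  refine ((Real.hasDerivAt_arccos (abs_lt.1 habs).1.ne' (abs_lt.1 habs).2.ne).comp t
    (hf.div_const a)).congr_deriv ?_
  rw [hsqrt]
  field_simp

theorem CkCircle.hasDerivAt_eval {k : ℕ} {E : Type*} [NormedAddCommGroup E] [NormedSpace ℝ E]
    (hk : 2 ≤ k) {c : ℝ → CkCircle k E} {σ : CkCircle k E} {p : ℝ → ℝ} {P t : ℝ}
    (hc : HasDerivAt c σ t) (hp : HasDerivAt p P t) :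
    HasDerivAt (fun t => c t (p t)) (P • deriv (c t) (p t) + σ (p t)) t := by
  simpa only [Function.comp_def, evJet_zero_apply, evJet_one_apply, _root_.smul_apply] using
    ((hasDerivAt_evJet (k := k) (E := E) (j := 0) hk (p t)).scomp t hp).clm_apply hc

section DirectionalDerivative

variable {n : ℕ} {r x₁ φ t P M : ℝ} {c : ℝ → CkCircle n Plane} {γ σ : CkCircle n Plane}
  {p m : ℝ → ℝ}

theorem hasDerivAt_areaForm_diag (hn : 2 ≤ n) (hc : HasDerivAt c σ t) (hp : HasDerivAt p P t) :
    HasDerivAt (fun t => areaForm (one_le_two.trans hn) (p t) (c t) (c t))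
      (P * cross (c t (p t)) (deriv (c t) (p t)) + areaForm (one_le_two.trans hn) (p t) σ (c t)
        + areaForm (one_le_two.trans hn) (p t) (c t) σ) t := by
  have hform : HasDerivAt (fun t => areaForm (one_le_two.trans hn) (p t))
      (P • areaDensity (one_le_two.trans hn) (p t)) t :=
    HasDerivAt.scomp (g₁ := areaForm (one_le_two.trans hn)) t (hasDerivAt_areaForm hn (p t)) hp
  have hform_left : HasDerivAt (fun t => areaForm (one_le_two.trans hn) (p t) (c t))
      ((P • areaDensity (one_le_two.trans hn) (p t)) (c t)
        + areaForm (one_le_two.trans hn) (p t) σ) t := hform.clm_apply hc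
  refine (hform_left.clm_apply hc).congr_deriv ?_
  simp only [add_apply, smul_apply, areaDensity_apply, smul_eq_mul]

theorem areaForm_sub_swap (hn : 2 ≤ n) (a b : ℝ) (f g : CkCircle n Plane) :
    areaForm (one_le_two.trans hn) b f g - areaForm (one_le_two.trans hn) a f g =
      cross (f b) (g b) - cross (f a) (g a) + ∫ ψ in a..b, cross (g ψ) (deriv f ψ) := by
  have hC1 : ((1 : ℕ) : WithTop ℕ∞) ≤ n := by exact_mod_cast one_le_two.trans hn
  rw [← integral_cross_deriv_eq_areaForm hn,
    integral_bilin_deriv_right cross (f.contDiff.of_le hC1) (g.contDiff.of_le hC1)]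
  simp only [cross_swap (deriv f _), intervalIntegral.integral_neg, sub_neg_eq_add]

theorem hasDerivAt_areaForm_sub (hn : 2 ≤ n) (hc : HasDerivAt c σ t) (hp : HasDerivAt p P t)
    (hm : HasDerivAt m M t) :
    HasDerivAt (fun t => areaForm (one_le_two.trans hn) (p t) (c t) (c t)
        - areaForm (one_le_two.trans hn) (m t) (c t) (c t))
      (2 * (∫ ψ in m t..p t, cross (σ ψ) (deriv (c t) ψ))
        + (P * cross (c t (p t)) (deriv (c t) (p t)) + cross (c t (p t)) (σ (p t)))
        - (M * cross (c t (m t)) (deriv (c t) (m t)) + cross (c t (m t)) (σ (m t)))) t := by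
  refine ((hasDerivAt_areaForm_diag hn hc hp).sub (hasDerivAt_areaForm_diag hn hc hm)).congr_deriv
    ?_
  linear_combination areaForm_sub_swap hn (m t) (p t) (c t) σ
    - integral_cross_deriv_eq_areaForm hn (m t) (p t) σ (c t)

/-- The velocity of the parameter `ψ` at which `γ` meets a circle centred at `γ φ`, when `γ` moves
in direction `σ` and the radius is kept. The quantities `P` and `M` of the theorem are its values at
`p_γ(φ)` and `m_γ(φ)`. -/
def paramVelocity (γ σ : ℝ → Plane) (φ ψ : ℝ) : ℝ :=
  ⟪σ φ - σ ψ, γ ψ - γ φ⟫ / ⟪deriv γ ψ, γ ψ - γ φ⟫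

theorem hasDerivAt_of_dist_eq (hn : 2 ≤ n) (hc : HasDerivAt c σ t)
    {q : CkCircle n Plane × ℝ → ℝ} (hq : DifferentiableAt ℝ q (c t, φ))
    (hdist : ∀ᶠ s in 𝓝 t, dist (c s (q (c s, φ))) (c s φ) = r)
    (htrans : ⟪deriv (c t) (q (c t, φ)), c t (q (c t, φ)) - c t φ⟫ ≠ 0) :
    HasDerivAt (fun s => q (c s, φ)) (paramVelocity (c t) σ φ (q (c t, φ))) t := by
  obtain ⟨P, hP⟩ : ∃ P, HasDerivAt (fun s => q (c s, φ)) P t :=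
    ⟨_, hq.hasFDerivAt.comp_hasDerivAt t (hc.prodMk (hasDerivAt_const t φ))⟩
  have hchord := (CkCircle.hasDerivAt_eval hn hc hP).fun_sub
    (CkCircle.hasDerivAt_eval hn hc (hasDerivAt_const t φ))
  have hconst : HasDerivAt (fun s => ‖c s (q (c s, φ)) - c s φ‖ ^ 2) 0 t := by
    refine (hasDerivAt_const t (r ^ 2)).congr_of_eventuallyEq ?_
    filter_upwards [hdist] with s hs
    rw [← dist_eq_norm, hs]
  have horth := hchord.norm_sq.unique hconst
  rw [real_inner_comm, zero_smul, zero_add, inner_sub_left, inner_add_left,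
    real_inner_smul_left] at horth
  refine hP.congr_deriv ?_
  rw [paramVelocity, eq_div_iff htrans, inner_sub_left]
  linarith

theorem hasDerivAt_nextParam (hn : 2 ≤ n) (hc : HasDerivAt c σ t)
    (hnear : ∀ᶠ γ : CkCircle n Plane in 𝓝 (c t), NearCircle r x₁ γ) (φ : ℝ) :
    HasDerivAt (fun t => nextParam r (c t) φ)
      (paramVelocity (c t) σ φ (nextParam r (c t) φ)) t :=
  hasDerivAt_of_dist_eq (q := fun z => nextParam r z.1 z.2) hn hc
    ((contDiffAt_nextParam (m := 1) hn one_ne_zero hnear φ).differentiableAt one_ne_zero)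
    ((hc.continuousAt.eventually hnear).mono fun _ hs => hs.dist_nextParam φ)
    (hnear.self_of_nhds.inner_nextParam_pos φ).ne'

theorem hasDerivAt_prevParam (hn : 2 ≤ n) (hc : HasDerivAt c σ t)
    (hnear : ∀ᶠ γ : CkCircle n Plane in 𝓝 (c t), NearCircle r x₁ γ) (φ : ℝ) :
    HasDerivAt (fun t => prevParam r (c t) φ)
      (paramVelocity (c t) σ φ (prevParam r (c t) φ)) t :=
  hasDerivAt_of_dist_eq (q := fun z => prevParam r z.1 z.2) hn hc
    ((contDiffAt_prevParam (m := 1) hn one_ne_zero hnear φ).differentiableAt one_ne_zero)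
    ((hc.continuousAt.eventually hnear).mono fun _ hs => hs.dist_prevParam φ)
    (hnear.self_of_nhds.inner_prevParam_neg φ).ne

theorem hasDerivAt_invariantFormula (hn : 2 ≤ n) (hc : HasDerivAt c σ t)
    (hnear : ∀ᶠ γ : CkCircle n Plane in 𝓝 (c t), NearCircle r x₁ γ) (φ : ℝ) :
    HasDerivAt (fun t => invariantFormula r (c t) φ) (1 / 2 * twiceDerivFormula r (c t) σ φ) t := by
  have hnext := hasDerivAt_nextParam hn hc hnear φ
  have hprev := hasDerivAt_prevParam hn hc hnear φ
  have heval := CkCircle.hasDerivAt_eval hn hc (hasDerivAt_const t φ)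
  have heval_next := CkCircle.hasDerivAt_eval hn hc hnext
  have heval_prev := CkCircle.hasDerivAt_eval hn hc hprev
  have harea := hasDerivAt_areaForm_sub hn hc hnext hprev
  have hchord := cross.hasDerivAt_of_bilinear (fun _ => heval)
    (fun _ => heval_next.fun_sub heval_prev)
  have hangle := hasDerivAt_arccos_div
    ((heval_next.fun_sub heval).inner ℝ (heval_prev.fun_sub heval))
    (hnear.self_of_nhds.abs_inner_next_prev_lt φ)
  refine ((((harea.fun_sub hchord).const_mul (1 / 2)).fun_add
    (hangle.const_mul (r ^ 2 / 2))).congr_deriv ?_).congr_of_eventuallyEq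
    (.of_forall fun t => invariantFormula_eq_areaForm hn r (c t) φ)
  simp only [twiceDerivFormula, paramVelocity, inner_perp, inner_sub_right (σ φ), ← pow_mul,
    zero_smul, zero_add]
  generalize nextParam r (c t) φ = p, prevParam r (c t) φ = m
  generalize √_ = D, ⟪σ φ - σ p, _⟫ / _ = P, ⟪σ φ - σ m, _⟫ / _ = M
  simp only [map_add, map_sub, map_smul, sub_apply, smul_eq_mul, inner_add_left,
    inner_add_right, inner_sub_left, inner_sub_right, real_inner_smul_left, real_inner_smul_right]
  ring

theorem two_mul_fderiv_apply_eq {k : ℕ} (hn : 2 ≤ n) {J : CkCircle n Plane → CkCircle k ℝ}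
    (hJ : DifferentiableAt ℝ J γ)
    (hnear : ∀ᶠ γ' : CkCircle n Plane in 𝓝 γ, NearCircle r x₁ γ')
    (hJφ : ∀ᶠ γ' in 𝓝 γ, J γ' φ = invariantFormula r γ' φ) (σ : CkCircle n Plane) :
    2 * (fderiv ℝ J γ σ) φ = twiceDerivFormula r γ σ φ := by
  obtain ⟨c, hzero, hc⟩ : ∃ c : ℝ → CkCircle n Plane, c 0 = γ ∧ HasDerivAt c σ 0 := by
    have hline := ((hasDerivAt_id (0 : ℝ)).smul_const σ).const_add γ
    rw [one_smul] at hline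
    exact ⟨_, by rw [id, zero_smul, add_zero], hline⟩
  subst hzero
  have hJc : HasDerivAt (fun t => J (c t) φ) ((fderiv ℝ J (c 0) σ) φ) 0 := by
    have hcomp := (CkCircle.evJet (Nat.zero_le k) φ).hasFDerivAt.comp_hasDerivAt (0 : ℝ)
      (hJ.hasFDerivAt.comp_hasDerivAt (0 : ℝ) hc)
    simpa only [CkCircle.evJet_zero_apply, Function.comp_def] using hcomp
  have hformula := (hasDerivAt_invariantFormula hn hc hnear φ).congr_of_eventuallyEq
    (hc.continuousAt.eventually hJφ)
  rw [hJc.unique hformula]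
  ring

end DirectionalDerivative

end CircInv

end

theorem mainTheorem2 (k ℓ : ℕ) (hℓ : 1 ≤ ℓ) (r R : ℝ) (hr : 0 < r) (hR : r / 2 < R) :
    ∃ V : Set (CircInv.CkCircle (k + ℓ + 1) CircInv.Plane),
      IsOpen V ∧ CircInv.circleCurve (k + ℓ + 1) R ∈ V ∧
      (∀ γ ∈ V, CircInv.IsEmbedded γ) ∧
      (∀ γ ∈ V, ∀ φ : ℝ, CircInv.MeetsTwice r γ φ ∧ CircInv.NonDegenerate r γ φ) ∧
      (∀ γ ∈ V, ∀ φ : ℝ, CircInv.invariant r γ φ = CircInv.invariantFormula r γ φ) ∧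
      ∃ J : CircInv.CkCircle (k + ℓ + 1) CircInv.Plane → CircInv.CkCircle k ℝ,
        (∀ γ ∈ V, ∀ φ : ℝ, J γ φ = CircInv.invariant r γ φ) ∧
        ContDiffOn ℝ ℓ J V ∧
        ∀ γ ∈ V, ∀ (σ : CircInv.CkCircle (k + ℓ + 1) CircInv.Plane) (φ : ℝ),
          2 * (fderiv ℝ J γ σ) φ = CircInv.twiceDerivFormula r γ σ φ := by
  obtain ⟨x₁, hcircle⟩ := CircInv.exists_eventually_nearCircle (by lia : 2 ≤ k + ℓ + 1) hr hR
  let V : Set (CircInv.CkCircle (k + ℓ + 1) CircInv.Plane) :=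
    {γ | ∀ᶠ γ' : CircInv.CkCircle (k + ℓ + 1) CircInv.Plane in 𝓝 γ, CircInv.NearCircle r x₁ γ'}
  have hV : IsOpen V := isOpen_setOfPred_eventually_nhds
  have hnear : ∀ γ ∈ V, CircInv.NearCircle r x₁ γ := fun _ hγ => hγ.self_of_nhds
  have hformula : ∀ γ ∈ V, ∀ φ, CircInv.invariant r γ φ = CircInv.invariantFormula r γ φ :=
    fun γ hγ => (hnear γ hγ).invariant_eq_invariantFormula
  have hperiodic : ∀ γ ∈ V, Function.Periodic (CircInv.invariantFormula r γ) (2 * π) :=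
    fun γ hγ φ => by simp only [← hformula γ hγ, CircInv.invariant, γ.periodic φ]
  have hsmooth : ContDiffOn ℝ (k + ℓ : ℕ)
      (Function.uncurry fun γ : CircInv.CkCircle (k + ℓ + 1) CircInv.Plane =>
        CircInv.invariantFormula r γ) (V ×ˢ univ) := fun z hz =>
    (CircInv.contDiffAt_invariantFormula le_rfl (by lia) hz.1 z.2).contDiffWithinAt
  obtain ⟨J, hJ, hJsmooth⟩ :=
    CircInv.CkCircle.exists_contDiffOn_eq_of_contDiffOn_uncurry ℓ hV hperiodic hsmooth
  refine ⟨V, hV, hcircle, fun γ hγ => (hnear γ hγ).isEmbedded,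
    fun γ hγ φ => ⟨(hnear γ hγ).meetsTwice φ, (hnear γ hγ).nonDegenerate φ⟩, hformula,
    J, fun γ hγ φ => (hJ γ hγ φ).trans (hformula γ hγ φ).symm, hJsmooth, fun γ hγ σ φ => ?_⟩
  exact CircInv.two_mul_fderiv_apply_eq (by lia)
    ((hJsmooth.contDiffAt (hV.mem_nhds hγ)).differentiableAt (by exact_mod_cast (by lia : ℓ ≠ 0)))
    hγ (Filter.eventually_of_mem (hV.mem_nhds hγ) fun γ' hγ' => hJ γ' hγ' φ) σ
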